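/- Let $0<\alpha<\pi$ and $\mu>1$, and write $B_r=\{X\in\mathbb R^2:|X|<r\}$. Let $D\subset\{(x_1,x_2): x_1>0\}$ be a bounded connected open set that is symmetric with respect to the $x_1$-axis, coincides near the origin with a cone of aperture angle $\alpha$, namely $D\cap B_\mu=\{|x_2|<\tan(\alpha/2)\,x_1\}\cap B_\mu$, and has a smooth boundary except at the vertex $(0,0)$. For $\epsilon>0$ let $\Omega_2=D+(\epsilon/2,0)$, let $\Omega_1$ be the mirror image of $\Omega_2$ in the $x_2$-axis, and let $V_1=(-\epsilon/2,0)$, $V_2=(\epsilon/2,0)$ be their vertices; so $\operatorname{dist}(\Omega_1,\Omega_2)=\epsilon$. Let $u$ be a solution of $$\begin{cases}\Delta u=\partial_2\delta_{(0,0)} & \text{in } \mathbb R^2\setminus\overline{\Omega_1\cup\Omega_2} \text{ (in the sense of distributions)},\\ u=c_j & \text{on }\partial\Omega_j,\ j=1,2,\\ \int_{\partial\Omega_j}\partial_\nu u\,ds=0, & j=1,2,\\ u(X)=O(|X|^{-1}) & \text{as }|X|\to\infty,\end{cases}$$ where $c_1,c_2$ are some constants, $\nu$ is the unit normal on $\partial\Omega_j\setminus\{V_j\}$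 pointing into $\Omega_j$, and $u$ is locally integrable in $\mathbb R^2\setminus\overline{\Omega_1\cup\Omega_2}$, is continuous on $\mathbb R^2\setminus(\Omega_1\cup\Omega_2\cup\{(0,0)\})$ and has an integrable normal derivative $\partial_\nu u$ on $\partial\Omega_j\setminus\{V_j\}$. (This is the potential excited by a vertical dipole placed at the origin, the center of the gap of the bow-tie.) Then there is a constant $C>0$, independent of $\epsilon$ and $u$, such that for every $\epsilon>0$ and every such $u$, the function $u$ is differentiable at each $X\in B_1\setminus(\overline{\Omega_1\cup\Omega_2}\cup\{(0,0)\})$ and $$|\nabla u(X)|\le \frac{C}{|X|^2}.$$ -/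

import Mathlib

open MeasureTheory Set Filter

noncomputable section

/-- The Euclidean plane. -/
abbrev Plane : Type := EuclideanSpace ℝ (Fin 2)

/-- `f` is a smooth defining function of `Ω` in the open neighbourhood `U` of `x`. -/
structure IsLocalDefiningFunction (Ω : Set Plane) (x : Plane) (U : Set Plane) (f : Plane → ℝ) :
    Prop where
  isOpen : IsOpen U
  mem : x ∈ U
  smooth : ContDiffOn ℝ (⊤ : ℕ∞) f U
  fderiv_ne_zero : ∀ y ∈ U, fderiv ℝ f y ≠ 0
  inter_eq : Ω ∩ U = {y | f y < 0} ∩ U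

/-- The boundary of `Ω` is smooth except possibly at the point `V`. -/
def HasSmoothBoundaryExceptAt (Ω : Set Plane) (V : Plane) : Prop :=
  ∀ x ∈ frontier Ω, x ≠ V → ∃ U f, IsLocalDefiningFunction Ω x U f

/-- `n` is the unit normal to `∂Ω` at the boundary point `x` that points into `Ω`. -/
def IsInwardUnitNormal (Ω : Set Plane) (x n : Plane) : Prop :=
  ‖n‖ = 1 ∧ ∃ U f, IsLocalDefiningFunction Ω x U f ∧
    ∀ w : Plane, fderiv ℝ f x w = -(‖fderiv ℝ f x‖ * inner ℝ n w)

/-- The inclusion on the right for `ε = 0`: its vertex is at the origin. It coincides in the disk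
`B_μ` with the open cone in the right half-plane that has its vertex at the origin, the
`x₁`-axis as its axis and the aperture angle `α`. -/
structure IsInclusionShape (α μ : ℝ) (D : Set Plane) : Prop where
  isOpen : IsOpen D
  isConnected : IsConnected D
  isBounded : Bornology.IsBounded D
  subset_rightHalfPlane : ∀ x ∈ D, 0 < x 0
  symm : ∀ x : Plane, x ∈ D ↔ !₂[x 0, -x 1] ∈ D
  cone : D ∩ Metric.ball 0 μ = {x : Plane | |x 1| < Real.tan (α / 2) * x 0} ∩ Metric.ball 0 μ
  smooth : HasSmoothBoundaryExceptAt D 0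

/-- The vertex `V₂ = (ε/2, 0)` of the inclusion on the right. -/
def vertexRight (ε : ℝ) : Plane := !₂[ε / 2, 0]

/-- The vertex `V₁ = (-ε/2, 0)` of the inclusion on the left. -/
def vertexLeft (ε : ℝ) : Plane := !₂[-(ε / 2), 0]

/-- The inclusion `Ω₂` on the right: the translate of `D` with vertex `V₂`. -/
def inclusionRight (D : Set Plane) (ε : ℝ) : Set Plane := {x | x - vertexRight ε ∈ D}

/-- The inclusion `Ω₁` on the left: the mirror image of `Ω₂` in the `x₂`-axis. -/
def inclusionLeft (D : Set Plane) (ε : ℝ) : Set Plane :=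
  {x | !₂[-x 0, x 1] ∈ inclusionRight D ε}

/-- For each `ε ≥ 0` the inclusion on the right coincides in the disk `B_μ` about the origin
(not about its vertex) with the translated cone, whose vertex is `(ε/2, 0)`. -/
theorem inclusionRight_inter_ball {α μ ε : ℝ} {D : Set Plane} (hα : 0 < α) (hα' : α < Real.pi)
    (hD : IsInclusionShape α μ D) (hε : 0 ≤ ε) :
    inclusionRight D ε ∩ Metric.ball 0 μ =
      {x : Plane | |x 1| < Real.tan (α / 2) * (x 0 - ε / 2)} ∩ Metric.ball 0 μ := by
  have ht : 0 < Real.tan (α / 2) :=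
    Real.tan_pos_of_pos_of_lt_pi_div_two (by linarith) (by linarith)
  have key : ∀ x : Plane, 0 < x 0 - ε / 2 → x ∈ Metric.ball (0 : Plane) μ →
      x - vertexRight ε ∈ Metric.ball (0 : Plane) μ := by
    intro x h0 hx
    rw [mem_ball_zero_iff] at hx ⊢
    refine lt_of_le_of_lt ?_ hx
    rw [EuclideanSpace.norm_eq, EuclideanSpace.norm_eq]
    apply Real.sqrt_le_sqrt
    simp only [vertexRight, Fin.sum_univ_two, Real.norm_eq_abs, sq_abs, PiLp.sub_apply]
    simp
    nlinarith
  have hc := fun y : Plane => Set.ext_iff.mp hD.cone y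
  ext x
  have hx := hc (x - vertexRight ε)
  have e0 : (x - vertexRight ε) 0 = x 0 - ε / 2 := by simp [vertexRight]
  have e1 : (x - vertexRight ε) 1 = x 1 := by simp [vertexRight]
  simp only [mem_inter_iff, mem_ofPred_eq, e0, e1] at hx
  simp only [mem_inter_iff, inclusionRight, mem_ofPred_eq]
  constructor
  · rintro ⟨h, hb⟩
    have h0 := hD.subset_rightHalfPlane _ h
    rw [e0] at h0
    exact ⟨(hx.mp ⟨h, key x h0 hb⟩).1, hb⟩
  · rintro ⟨h, hb⟩
    have h0 : 0 < x 0 - ε / 2 := by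
      have := (abs_nonneg (x 1)).trans_lt h
      exact (pos_iff_pos_of_mul_pos this).mp ht
    exact ⟨(hx.mpr ⟨h, key x h0 hb⟩).1, hb⟩

/-- `∫_{∂Ω} ∂_ν u ds = 0`: at each boundary point other than the vertex `V` the function `u` has a
(one-sided) derivative `g` in the direction of the unit normal `ν` pointing into `Ω`, taken from
outside `Ω`, and `g` is integrable with respect to arc length, with integral zero. -/
def HasZeroFlux (Ω : Set Plane) (V : Plane) (u : Plane → ℝ) : Prop :=
  ∃ g : Plane → ℝ,
    (∀ x ∈ frontier Ω, x ≠ V → ∃ n, IsInwardUnitNormal Ω x n ∧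
      HasDerivWithinAt (fun t : ℝ => u (x + t • n)) (g x) (Iic 0) 0) ∧
    IntegrableOn g (frontier Ω) (Measure.hausdorffMeasure (1 : ℝ)) ∧
    ∫ x in frontier Ω, g x ∂(Measure.hausdorffMeasure (1 : ℝ)) = 0

/-- `Δ u = a · ∇ δ_p` in the open set `W`, in the sense of distributions. -/
def LaplaceEqDipole (W : Set Plane) (a p : Plane) (u : Plane → ℝ) : Prop :=
  LocallyIntegrableOn u W ∧
  ∀ φ : Plane → ℝ, ContDiff ℝ (⊤ : ℕ∞) φ → HasCompactSupport φ → tsupport φ ⊆ W →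
    ∫ x, u x * Laplacian.laplacian φ x = -(fderiv ℝ φ p a)

/-- `u` is a potential excited by the emitter of dipole type with direction `a` and location `p`
in the presence of the perfectly conducting inclusions `Ω₁`, `Ω₂` with vertices `V₁`, `V₂`. -/
structure IsEmitterPotential (Ω₁ Ω₂ : Set Plane) (V₁ V₂ a p : Plane) (u : Plane → ℝ) : Prop where
  continuousOn : ContinuousOn u (Ω₁ ∪ Ω₂ ∪ {p})ᶜ
  equation : LaplaceEqDipole (closure (Ω₁ ∪ Ω₂))ᶜ a p u
  constant₁ : ∃ c₁ : ℝ, ∀ x ∈ frontier Ω₁, u x = c₁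
  constant₂ : ∃ c₂ : ℝ, ∀ x ∈ frontier Ω₂, u x = c₂
  flux₁ : HasZeroFlux Ω₁ V₁ u
  flux₂ : HasZeroFlux Ω₂ V₂ u
  decay : u =O[Bornology.cobounded Plane] fun x => ‖x‖⁻¹

end

/-! The potential is compared with the free dipole N(x) = x₂ / (2π|x|²), which solves the same
distributional equation. By Weyl's lemma u − N agrees off the origin with a function H that is
harmonic in the whole exterior, the origin included. Since N is odd in x₂, twice the even part of H
is a potential without source: it is constant on each boundary, carries no flux and tends to 0 at
infinity. If its larger boundary value were positive, it would be the maximum, and Hopf's boundary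
point lemma on a straight edge would make the corresponding flux nonzero. So this potential vanishes
(`IsSourceFreePotential.eq_zero`), whence u is odd in x₂ and both constants c₁, c₂ are 0.

In the part of the exterior above the axis, u vanishes on the boundary except at the origin, and the
maximum principle gives 0 ≤ u ≤ N (`IsDominatedPotential`). Hence u is at most M = 1/(π|X|) on the
upper part of a disk about X with radius comparable to |X|, whatever ε is. Inside B_μ the upper
region is an intersection of three half-planes, bounded by the axis and by the lines through the two
upper edges. It has no reentrant corner, so vertices cause no blow-up: a half-plane barrier
(`le_of_mem_halfPlane`) bounds u linearly in the distance to either edge line, and N itself does so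
at the axis.

If d is the distance from X to the nearest of the three lines, the interior gradient estimate
(`norm_fderiv_le_of_nonneg`) is applied on a disk of radius comparable to min(d, |X|). The factor d
cancels when d is small, and M/|X| ~ |X|⁻² remains. Oddness gives the lower half, and continuity of
the gradient gives the axis. -/

namespace BowTie

open Topology InnerProductSpace Laplacian Metric

/-! ### Invariance of harmonicity under isometries and translations -/

section Isometry

variable {E E' : Type*} [NormedAddCommGroup E] [InnerProductSpace ℝ E] [FiniteDimensional ℝ E]
  [NormedAddCommGroup E'] [InnerProductSpace ℝ E'] [FiniteDimensional ℝ E']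

/-- The Laplacian is the trace of the second derivative over any orthonormal basis, so the standard
basis of the source may be matched with its image under the isometry. -/
theorem laplacian_comp_linearIsometryEquiv (f : E → ℝ) (e : E' ≃ₗᵢ[ℝ] E) (x : E') :
    Δ (fun y => f (e y)) x = Δ f (e x) := by
  have h : ∀ v : E', iteratedFDeriv ℝ 2 (fun y => f (e y)) x ![v, v]
      = iteratedFDeriv ℝ 2 f (e x) ![e v, e v] := by
    intro v
    have := e.toContinuousLinearEquiv.iteratedFDerivWithin_comp_right (𝕜 := ℝ) (f := f)
      (s := univ) uniqueDiffOn_univ (x := x) (mem_univ _) 2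
    simp only [preimage_univ, iteratedFDerivWithin_univ] at this
    have h2 : (f ∘ e.toContinuousLinearEquiv) = fun y => f (e y) := rfl
    rw [h2] at this
    rw [this]
    simp only [ContinuousMultilinearMap.compContinuousLinearMap_apply]
    congr 1
    ext i
    fin_cases i <;> rfl
  rw [laplacian_eq_iteratedFDeriv_stdOrthonormalBasis,
    laplacian_eq_iteratedFDeriv_orthonormalBasis f ((stdOrthonormalBasis ℝ E').map e)]
  simp [h]

theorem laplacian_comp_add_right (f : E → ℝ) (a x : E) :
    Δ (fun y => f (y + a)) x = Δ f (x + a) := by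
  simp only [laplacian_eq_iteratedFDeriv_stdOrthonormalBasis, iteratedFDeriv_comp_add_right]

theorem HarmonicAt.comp_linearIsometryEquiv {f : E → ℝ} (e : E' ≃ₗᵢ[ℝ] E) {x : E'}
    (h : HarmonicAt f (e x)) : HarmonicAt (fun y => f (e y)) x := by
  refine ⟨h.1.comp x e.toContinuousLinearEquiv.contDiff.contDiffAt, ?_⟩
  have := e.continuous.continuousAt.eventually h.2
  filter_upwards [this] with y hy
  rw [laplacian_comp_linearIsometryEquiv, hy]
  rfl

theorem HarmonicAt.comp_add_right {f : E → ℝ} (a : E) {x : E}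
    (h : HarmonicAt f (x + a)) : HarmonicAt (fun y => f (y + a)) x := by
  refine ⟨h.1.comp x (by fun_prop), ?_⟩
  have hc : ContinuousAt (fun y : E => y + a) x := by fun_prop
  filter_upwards [hc.eventually h.2] with y hy
  rw [laplacian_comp_add_right, hy]
  rfl

end Isometry

/-! ### Holomorphic representation and maximum principles -/

/-- The standard isometry from the complex plane to the Euclidean plane. -/
noncomputable abbrev ofComplex : ℂ ≃ₗᵢ[ℝ] Plane := Complex.orthonormalBasisOneI.repr

theorem HarmonicOnNhd.comp_ofComplex {f : Plane → ℝ} {q : Plane} {R : ℝ}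
    (h : HarmonicOnNhd f (ball q R)) :
    HarmonicOnNhd (fun z => f (ofComplex z)) (ball (ofComplex.symm q) R) := by
  intro z hz
  refine HarmonicAt.comp_linearIsometryEquiv ofComplex (h _ ?_)
  rw [mem_ball] at hz ⊢
  rwa [← ofComplex.apply_symm_apply q, ofComplex.dist_map]

/-- A harmonic function on a disk is the real part of a holomorphic function. -/
theorem exists_holomorphic_re {f : Plane → ℝ} {q : Plane} {R : ℝ}
    (h : HarmonicOnNhd f (ball q R)) :
    ∃ F : ℂ → ℂ, AnalyticOnNhd ℂ F (ball 0 R) ∧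
      ∀ z ∈ ball (0 : ℂ) R, (F z).re = f (q + ofComplex z) := by
  obtain ⟨F, hF, hre⟩ := (HarmonicOnNhd.comp_ofComplex h).exists_analyticOnNhd_ball_re_eq
  have hmem : ∀ z ∈ ball (0 : ℂ) R, z + ofComplex.symm q ∈ ball (ofComplex.symm q) R := by
    intro z hz
    simpa [mem_ball, dist_eq_norm] using hz
  refine ⟨fun z => F (z + ofComplex.symm q), fun z hz => ?_, fun z hz => ?_⟩
  · exact (hF _ (hmem z hz)).comp_of_eq (f := fun z => z + ofComplex.symm q)
      (analyticAt_id.add analyticAt_const) rfl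
  · have := hre (hmem z hz)
    simp only at this
    rw [this, map_add, LinearIsometryEquiv.apply_symm_apply, add_comm]

/-- With f = Re F and F holomorphic, |exp F| = exp f, so this is the maximum modulus principle for
exp F. -/
theorem HarmonicAt.eventuallyEq_of_isLocalMax {f : Plane → ℝ} {x : Plane}
    (h : HarmonicAt f x) (hm : IsLocalMax f x) : ∀ᶠ y in 𝓝 x, f y = f x := by
  obtain ⟨R, hR, hball⟩ := Metric.eventually_nhds_iff_ball.mp h.eventually
  obtain ⟨F, hF, hre⟩ := exists_holomorphic_re hball
  have h0 : (0 : ℂ) ∈ ball (0 : ℂ) R := mem_ball_self hR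
  have hcont : ContinuousAt (fun z : ℂ => x + ofComplex z) 0 := by fun_prop
  have hcont' : Tendsto (fun z : ℂ => x + ofComplex z) (𝓝 0) (𝓝 x) := by
    simpa [ContinuousAt] using hcont
  have hball0 : ∀ᶠ z in 𝓝 (0 : ℂ), z ∈ ball (0 : ℂ) R := isOpen_ball.mem_nhds h0
  have key := Complex.eventually_eq_of_isLocalMax_norm (f := fun z => Complex.exp (F z)) (c := 0)
    (by
      filter_upwards [hball0] with z hz
      exact (hF z hz).differentiableAt.cexp)
    (by
      filter_upwards [hball0, hcont'.eventually hm] with z hz hmz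
      simp only [Function.comp, Complex.norm_exp, hre z hz, hre 0 h0]
      simpa using hmz)
  have hinv : Tendsto (fun y : Plane => ofComplex.symm (y - x)) (𝓝 x) (𝓝 0) := by
    have : ContinuousAt (fun y : Plane => ofComplex.symm (y - x)) x := by fun_prop
    simpa [ContinuousAt] using this
  filter_upwards [hinv.eventually key, hinv.eventually hball0] with y hy hyb
  have h1 := congrArg (fun z => ‖z‖) hy
  simp only [Complex.norm_exp, hre _ hyb, hre 0 h0] at h1
  have h2 := Real.exp_injective h1
  rwa [LinearIsometryEquiv.apply_symm_apply, map_zero, add_zero, add_sub_cancel] at h2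

/-- The maximum principle for a harmonic function on an arbitrary open set. -/
theorem le_zero_of_harmonicOnNhd {U : Set Plane} {f : Plane → ℝ} (hU : IsOpen U)
    (hf : HarmonicOnNhd f U)
    (hfr : ∀ x ∈ frontier U, ∀ δ > 0, ∀ᶠ y in 𝓝[U] x, f y ≤ δ)
    (hinf : ∀ δ > 0, ∀ᶠ y in Bornology.cobounded Plane, y ∈ U → f y ≤ δ) :
    ∀ x ∈ U, f x ≤ 0 := by
  by_contra! hcon
  obtain ⟨x₀, hx₀, hpos⟩ := hcon
  -- The condition at the frontier makes this superlevel set closed in the plane, and the condition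
  -- at infinity makes it bounded. So f attains its supremum over U.
  set K : Set Plane := {x ∈ U | f x₀ ≤ f x} with hK
  have hKcl : IsClosed K := by
    refine isClosed_of_closure_subset fun y hy => ?_
    have hyU : y ∈ closure U := closure_mono (fun z hz => hz.1) hy
    have hfreq : ∃ᶠ z in 𝓝 y, z ∈ K := mem_closure_iff_frequently.mp hy
    by_cases hyU' : y ∈ U
    · refine ⟨hyU', ?_⟩
      have hc : ContinuousAt f y := (hf y hyU').1.continuousAt
      by_contra! hlt
      obtain ⟨z, hz, hz'⟩ := (hfreq.and_eventually (hc.eventually_lt_const hlt)).exists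
      exact absurd hz' (not_lt.mpr hz.2)
    · have hfrm : y ∈ frontier U := by
        rw [hU.frontier_eq]; exact ⟨hyU, hyU'⟩
      have := hfr y hfrm (f x₀ / 2) (by positivity)
      rw [eventually_nhdsWithin_iff] at this
      obtain ⟨z, hz, hz'⟩ := (hfreq.and_eventually this).exists
      have := hz' hz.1
      have := hz.2
      linarith
  have hKb : Bornology.IsBounded K := by
    have := hinf (f x₀ / 2) (by positivity)
    rw [← Bornology.isCobounded_compl_iff]
    filter_upwards [this] with y hy hyK
    have := hy hyK.1
    have := hyK.2
    linarith
  have hKc : IsCompact K := isCompact_of_isClosed_isBounded hKcl hKb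
  have hfK : ContinuousOn f K := fun y hy => (hf y hy.1).1.continuousAt.continuousWithinAt
  obtain ⟨m, hmK, hmax⟩ := hKc.exists_isMaxOn ⟨x₀, hx₀, le_rfl⟩ hfK
  -- The set of maximum points is closed as a part of K and open by the local maximum principle. By
  -- connectedness it is the whole plane, which is not compact.
  set S : Set Plane := {x ∈ U | f m ≤ f x} with hS
  have hglob : ∀ y ∈ U, f y ≤ f m := by
    intro y hy
    rcases le_total (f x₀) (f y) with h | h
    · exact hmax ⟨hy, h⟩
    · exact h.trans hmK.2
  have hScl : IsClosed S := by
    have : S = K ∩ f ⁻¹' (Ici (f m)) := by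
      ext y
      simp only [hS, hK, mem_ofPred_eq, mem_inter_iff, mem_preimage, mem_Ici]
      exact ⟨fun h => ⟨⟨h.1, hmK.2.trans h.2⟩, h.2⟩, fun h => ⟨h.1.1, h.2⟩⟩
    rw [this]
    exact hfK.preimage_isClosed_of_isClosed hKcl isClosed_Ici
  have hSop : IsOpen S := by
    rw [isOpen_iff_mem_nhds]
    intro y hy
    have hloc : IsLocalMax f y := by
      filter_upwards [hU.mem_nhds hy.1] with z hz
      exact (hglob z hz).trans hy.2
    filter_upwards [hU.mem_nhds hy.1,
      HarmonicAt.eventuallyEq_of_isLocalMax (hf y hy.1) hloc] with z hz hzeq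
    exact ⟨hz, by rw [hzeq]; exact hy.2⟩
  have huniv : S = univ := IsClopen.eq_univ ⟨hScl, hSop⟩ ⟨m, hmK.1, le_rfl⟩
  have hSK : S ⊆ K := fun y hy => ⟨hy.1, hmK.2.trans hy.2⟩
  exact NoncompactSpace.noncompact_univ (hKc.of_isClosed_subset isClosed_univ (huniv ▸ hSK))

/-- The maximum principle on a bounded open set. -/
theorem le_zero_of_harmonicOnNhd_of_isBounded {U : Set Plane} {f : Plane → ℝ} (hU : IsOpen U)
    (hUb : Bornology.IsBounded U) (hf : HarmonicOnNhd f U) (hc : ContinuousOn f (closure U))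
    (hfr : ∀ x ∈ frontier U, f x ≤ 0) : ∀ x ∈ U, f x ≤ 0 := by
  refine le_zero_of_harmonicOnNhd hU hf (fun x hx δ hδ => ?_) (fun δ _ => ?_)
  · have h1 : ContinuousWithinAt f U x :=
      (hc x (frontier_subset_closure hx)).mono subset_closure
    filter_upwards [h1.eventually_lt_const ((hfr x hx).trans_lt hδ)] with y hy using hy.le
  · filter_upwards [Bornology.isCobounded_compl_iff.mpr hUb] with y hy hyU using absurd hyU hy

/-- A nonnegative harmonic function on a connected open set vanishes identically if it has a
zero. -/
theorem eqOn_zero_of_nonneg {S : Set Plane} {v : Plane → ℝ} (hS : IsOpen S)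
    (hSc : IsPreconnected S) (hv : HarmonicOnNhd v S) (h0 : ∀ x ∈ S, 0 ≤ v x) {x : Plane}
    (hx : x ∈ S) (hvx : v x = 0) : ∀ y ∈ S, v y = 0 := by
  have hloc : ∀ y ∈ S, v y = 0 → ∀ᶠ z in 𝓝 y, v z = 0 := by
    intro y hy hvy
    have := HarmonicAt.eventuallyEq_of_isLocalMax (hv y hy).neg (by
      filter_upwards [hS.mem_nhds hy] with z hz
      simp only [Pi.neg_apply, hvy]
      linarith [h0 z hz])
    filter_upwards [this] with z hz
    simpa [hvy] using hz
  -- The points near which v vanishes form an open set. It is also relatively closed in S, since a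
  -- limit of such points is a zero of v and hence a minimum.
  have hsub : S ⊆ {y | ∀ᶠ z in 𝓝 y, v z = 0} := by
    refine hSc.subset_of_closure_inter_subset ?_ ⟨x, hx, hloc x hx hvx⟩ ?_
    · exact isOpen_setOfPred_eventually_nhds
    · rintro y ⟨hy, hyS⟩
      refine hloc y hyS ?_
      have hfreq := mem_closure_iff_frequently.mp hy
      by_contra hne
      have := (hv y hyS).1.continuousAt.eventually_ne hne
      obtain ⟨z, hz, hz'⟩ := (hfreq.and_eventually this).exists
      exact hz' hz.self_of_nhds
  exact fun y hy => (hsub hy).self_of_nhds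

end BowTie

/-! ### Gradient estimate, Harnack inequality and limits of harmonic functions -/

namespace BowTie

open Topology InnerProductSpace Laplacian Metric

/-- The chain rule for Re F; its use is that ‖df‖ ≤ |F'(0)|, which Cauchy's estimate controls. -/
theorem hasFDerivAt_of_re_eq {f : Plane → ℝ} {F : ℂ → ℂ} {q : Plane} {R : ℝ} (hR : 0 < R)
    (hF : DifferentiableAt ℂ F 0) (hre : ∀ z ∈ ball (0 : ℂ) R, (F z).re = f (q + ofComplex z)) :
    HasFDerivAt f (Complex.reCLM ∘L ((ContinuousLinearMap.toSpanSingleton ℂ (deriv F 0)).restrictScalars ℝ) ∘L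
      (ofComplex.symm.toContinuousLinearEquiv : Plane →L[ℝ] ℂ)) q := by
  have hsub : HasFDerivAt (fun y : Plane => ofComplex.symm (y - q))
      (ofComplex.symm.toContinuousLinearEquiv : Plane →L[ℝ] ℂ) q := by
    have h1 := (ofComplex.symm.toContinuousLinearEquiv : Plane →L[ℝ] ℂ).hasFDerivAt
      (x := q - q)
    have h2 : HasFDerivAt (fun y : Plane => y - q) (ContinuousLinearMap.id ℝ Plane) q :=
      (hasFDerivAt_id q).sub_const q
    have h3 := HasFDerivAt.comp (g := fun y : Plane => ofComplex.symm y)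
      (f := fun y : Plane => y - q) q h1 h2
    exact h3
  have hF' : HasFDerivAt F ((ContinuousLinearMap.toSpanSingleton ℂ (deriv F 0)).restrictScalars ℝ)
      (ofComplex.symm (q - q)) := by
    rw [sub_self, map_zero]
    exact hF.hasDerivAt.hasFDerivAt.restrictScalars ℝ
  have hcomp := (Complex.reCLM.hasFDerivAt).comp q (hF'.comp q hsub)
  refine hcomp.congr_of_eventuallyEq ?_
  filter_upwards [ball_mem_nhds q hR] with y hy
  have hz : ofComplex.symm (y - q) ∈ ball (0 : ℂ) R := by
    rw [mem_ball_zero_iff, LinearIsometryEquiv.norm_map, ← dist_eq_norm]; exact hy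
  have := hre _ hz
  rw [LinearIsometryEquiv.apply_symm_apply, add_sub_cancel] at this
  exact this.symm

/-- The gradient estimate for bounded nonnegative harmonic functions. -/
theorem norm_fderiv_le_of_nonneg {f : Plane → ℝ} {q : Plane} {R M : ℝ} (hR : 0 < R)
    (h : HarmonicOnNhd f (ball q R)) (h0 : ∀ x ∈ ball q R, 0 ≤ f x)
    (hM : ∀ x ∈ ball q R, f x ≤ M) (hMpos : 0 < M) : ‖fderiv ℝ f q‖ ≤ 8 * M / R := by
  obtain ⟨F, hF, hre⟩ := exists_holomorphic_re h
  have hmem : ∀ z ∈ ball (0 : ℂ) R, q + ofComplex z ∈ ball q R := by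
    intro z hz
    rw [mem_ball, dist_eq_norm, add_sub_cancel_left, LinearIsometryEquiv.norm_map]
    simpa using hz
  have h0R : (0 : ℂ) ∈ ball (0 : ℂ) R := mem_ball_self hR
  have hd : DifferentiableAt ℂ F 0 := (hF 0 h0R).differentiableAt
  -- Borel–Carathéodory for F − F(0), whose real part is at most M because f ≤ M and f(q) ≥ 0. On
  -- |z| = R/2 the factor 2|z|/(R − |z|) equals 2.
  have hbound : ∀ z ∈ sphere (0 : ℂ) (R / 2), ‖F z - F 0‖ ≤ 2 * M := by
    intro z hz
    rw [mem_sphere_zero_iff_norm] at hz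
    have := Complex.borelCaratheodory_zero (f := fun z => F z - F 0) (z := z) hMpos
      (hF.differentiableOn.sub_const _)
      (by
        intro w hw
        simp only [mem_ofPred_eq, Complex.sub_re, hre w hw, hre 0 h0R]
        linarith [hM _ (hmem w hw), h0 _ (hmem 0 h0R)]) hR
      (by rw [mem_ball_zero_iff, hz]; linarith) (by simp)
    rw [hz] at this
    refine this.trans (le_of_eq ?_)
    field_simp
    ring
  have hderiv : ‖deriv F 0‖ ≤ 2 * M / (R / 2) := by
    have hd' : deriv (fun z => F z - F 0) 0 = deriv F 0 := by simp
    rw [← hd']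
    refine Complex.norm_deriv_le_of_forall_mem_sphere_norm_le (by positivity) ?_ hbound
    refine DifferentiableOn.diffContOnCl (DifferentiableOn.sub_const ?_ _)
    refine hF.differentiableOn.mono ?_
    exact closure_ball_subset_closedBall.trans (closedBall_subset_ball (by linarith))
  rw [(hasFDerivAt_of_re_eq hR hd hre).fderiv]
  refine ContinuousLinearMap.opNorm_le_bound _ (by positivity) fun v => ?_
  simp only [ContinuousLinearMap.comp_apply]
  calc _ ≤ ‖deriv F 0 * ofComplex.symm v‖ := by
        rw [mul_comm]
        exact Complex.abs_re_le_norm _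
    _ = ‖deriv F 0‖ * ‖v‖ := by rw [norm_mul, LinearIsometryEquiv.norm_map]
    _ ≤ _ := by
      gcongr
      refine hderiv.trans ?_
      rw [div_le_div_iff₀ (by positivity) hR]
      nlinarith [mul_pos hMpos hR]

/-- Harnack's inequality, lower bound. -/
theorem harnack_lower {v : Plane → ℝ} {q y : Plane} {R : ℝ}
    (hv : HarmonicOnNhd v (ball q R)) (hc : ContinuousOn v (closedBall q R))
    (h0 : ∀ x ∈ closedBall q R, 0 ≤ v x) (hy : y ∈ ball q R) :
    (R - dist y q) / (R + dist y q) * v q ≤ v y := by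
  have hR : 0 < R := pos_of_mem_ball hy
  set c : ℂ := ofComplex.symm q
  set w : ℂ := ofComplex.symm y
  set V : ℂ → ℝ := fun z => v (ofComplex z)
  have hw : w ∈ ball c R := by
    rw [mem_ball, LinearIsometryEquiv.dist_map]; exact hy
  have hmaps : MapsTo ofComplex (closedBall c R) (closedBall q R) := by
    intro z hz
    rw [mem_closedBall] at hz ⊢
    rwa [← ofComplex.apply_symm_apply q, ofComplex.dist_map]
  have hVc : ContinuousOn V (closedBall c R) := hc.comp ofComplex.continuous.continuousOn hmaps
  have hV : HarmonicContOnCl V (ball c R) :=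
    HarmonicContOnCl.mk_ball (HarmonicOnNhd.comp_ofComplex hv) hVc
  have h1 := hV.circleAverage_poissonKernel_smul hw
  have h2 := InnerProductSpace.HarmonicContOnCl.circleAverage_eq (f := V) (c := c) (R := R)
    (by rwa [abs_of_pos hR])
  have hVw : V w = v y := by simp only [V, w, LinearIsometryEquiv.apply_symm_apply]
  have hVcq : V c = v q := by simp only [V, c, LinearIsometryEquiv.apply_symm_apply]
  have hdist : dist y q = ‖w - c‖ := by
    rw [← dist_eq_norm, LinearIsometryEquiv.dist_map]
  have hVs : ContinuousOn V (sphere c |R|) :=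
    hVc.mono (by rw [abs_of_pos hR]; exact sphere_subset_closedBall)
  -- Both values become circle averages, v(y) with the Poisson kernel and v(q) by the mean value
  -- property. It remains to bound the kernel below by (R − |y − q|)/(R + |y − q|).
  rw [← hVw, ← hVcq, ← h1, ← h2, ← smul_eq_mul, ← Real.circleAverage_fun_smul, hdist]
  refine Real.circleAverage_mono ?_ ?_ ?_
  · exact ContinuousOn.circleIntegrable' (by fun_prop)
  · refine ContinuousOn.circleIntegrable' (ContinuousOn.smul ?_ hVs)
    rw [abs_of_pos hR]
    have hne : ∀ z ∈ sphere c R, ‖z - c - (w - c)‖ ^ 2 ≠ 0 := by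
      intro z hz
      have : z ≠ w := by
        rintro rfl
        rw [mem_sphere] at hz; rw [mem_ball] at hw; linarith
      rw [sub_sub_sub_cancel_right]
      exact pow_ne_zero 2 (norm_ne_zero_iff.mpr (sub_ne_zero.mpr this))
    have : poissonKernel c w = fun z =>
        (‖z - c‖ ^ 2 - ‖w - c‖ ^ 2) / ‖(z - c) - (w - c)‖ ^ 2 := by
      ext z; exact poissonKernel_def c w z
    rw [this]
    exact ContinuousOn.div (by fun_prop) (by fun_prop) hne
  · intro z hz
    rw [abs_of_pos hR] at hz
    have hz' : ofComplex z ∈ closedBall q R := hmaps (sphere_subset_closedBall hz)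
    simp only [smul_eq_mul, Pi.smul_apply', V]
    refine mul_le_mul_of_nonneg_right ?_ (h0 _ hz')
    rw [poissonKernel_eq_re_herglotzRieszKernel]
    exact le_re_herglotzRieszKernel hz hw

/-- A uniform limit of harmonic functions on a disk is harmonic. -/
theorem exists_harmonic_limit {f : ℕ → Plane → ℝ} {q : Plane} {R : ℝ} (hR : 0 < R)
    (hf : ∀ n, HarmonicOnNhd (f n) (ball q R))
    (hu : UniformCauchySeqOn f atTop (ball q R)) :
    ∃ H : Plane → ℝ, HarmonicOnNhd H (ball q (R / 2)) ∧
      ∀ x ∈ ball q (R / 2), Tendsto (fun n => f n x) atTop (𝓝 (H x)) := by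
  choose F hF hre using fun n => exists_holomorphic_re (hf n)
  have h0R : (0 : ℂ) ∈ ball (0 : ℂ) R := mem_ball_self hR
  have hmem : ∀ z ∈ ball (0 : ℂ) R, q + ofComplex z ∈ ball q R := by
    intro z hz
    rw [mem_ball, dist_eq_norm, add_sub_cancel_left, LinearIsometryEquiv.norm_map]
    simpa using hz
  -- The imaginary constants are normalised so that G n 0 is real. Otherwise the imaginary parts
  -- could drift although the f n converge.
  set G : ℕ → ℂ → ℂ := fun n z => F n z - F n 0 + (f n q : ℂ) with hG
  have hGre : ∀ n, ∀ z ∈ ball (0 : ℂ) R, (G n z).re = f n (q + ofComplex z) := by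
    intro n z hz
    simp [hG, hre n z hz, hre n 0 h0R]
  have hsub : ball (0 : ℂ) (R / 2) ⊆ ball 0 R := ball_subset_ball (by linarith)
  have hGd : ∀ n, DifferentiableOn ℂ (G n) (ball 0 R) := fun n =>
    ((hF n).differentiableOn.sub_const _).add_const _
  have hGu : UniformCauchySeqOn G atTop (ball (0 : ℂ) (R / 2)) := by
    rw [Metric.uniformCauchySeqOn_iff] at hu ⊢
    intro δ hδ
    obtain ⟨N, hN⟩ := hu (δ / 8) (by positivity)
    refine ⟨N, fun m hm n hn z hz => ?_⟩
    have hb : ∀ w ∈ ball (0 : ℂ) R, |(G m w).re - (G n w).re| < δ / 8 := by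
      intro w hw
      rw [hGre m w hw, hGre n w hw, ← Real.dist_eq]
      exact hN m hm n hn _ (hmem w hw)
    have hG0 : ∀ k, G k 0 = (f k q : ℂ) := by intro k; simp [hG]
    have hfq := hN m hm n hn q (mem_ball_self hR)
    have hbc := Complex.borelCaratheodory (f := fun w => G m w - G n w) (z := z)
      (M := δ / 8) (by positivity) ((hGd m).sub (hGd n))
      (by
        intro w hw
        simp only [mem_ofPred_eq, Complex.sub_re]
        exact (le_abs_self _).trans (hb w hw).le) hR (hsub hz)
    have hn0 : ‖G m 0 - G n 0‖ ≤ δ / 8 := by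
      rw [hG0, hG0, ← Complex.ofReal_sub, Complex.norm_real, ← dist_eq_norm]
      exact hfq.le
    have hz' : ‖z‖ < R / 2 := by simpa using hz
    have hden : 0 < R - ‖z‖ := by linarith
    rw [dist_eq_norm]
    refine lt_of_le_of_lt hbc ?_
    -- For |z| < R/2 one has |z|/(R − |z|) ≤ 1 and (R + |z|)/(R − |z|) ≤ 3, so the two terms add up
    -- to at most 5δ/8.
    have e1 : 2 * (δ / 8) * ‖z‖ / (R - ‖z‖) ≤ 2 * (δ / 8) := by
      rw [div_le_iff₀ hden]
      have : (0:ℝ) < δ / 8 := by positivity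
      nlinarith
    have e2 : ‖G m 0 - G n 0‖ * (R + ‖z‖) / (R - ‖z‖) ≤ (δ / 8) * 3 := by
      rw [div_le_iff₀ hden]
      calc ‖G m 0 - G n 0‖ * (R + ‖z‖) ≤ (δ / 8) * (R + ‖z‖) := by gcongr
        _ ≤ (δ / 8) * (3 * (R - ‖z‖)) := by gcongr; linarith
        _ = _ := by ring
    linarith
  have hlim : ∀ z ∈ ball (0 : ℂ) (R / 2), ∃ l, Tendsto (fun n => G n z) atTop (𝓝 l) :=
    fun z hz => cauchySeq_tendsto_of_complete (hGu.cauchySeq hz)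
  choose! L hL using hlim
  have hunif : TendstoUniformlyOn G L atTop (ball (0 : ℂ) (R / 2)) :=
    hGu.tendstoUniformlyOn_of_tendsto hL
  have hLd : DifferentiableOn ℂ L (ball (0 : ℂ) (R / 2)) :=
    hunif.tendstoLocallyUniformlyOn.differentiableOn
      (Eventually.of_forall fun n => (hGd n).mono hsub) isOpen_ball
  have hmem' : ∀ x ∈ ball q (R / 2), ofComplex.symm (x + -q) ∈ ball (0 : ℂ) (R / 2) := by
    intro x hx
    rw [mem_ball_zero_iff, LinearIsometryEquiv.norm_map, ← sub_eq_add_neg, ← dist_eq_norm]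
    exact hx
  refine ⟨fun x => (L (ofComplex.symm (x + -q))).re, fun x hx => ?_, fun x hx => ?_⟩
  · have h1 : HarmonicAt (fun z => (L z).re) (ofComplex.symm (x + -q)) :=
      (hLd.analyticAt (isOpen_ball.mem_nhds (hmem' x hx))).harmonicAt_re
    exact HarmonicAt.comp_add_right (f := fun y => (L (ofComplex.symm y)).re) (-q)
      (HarmonicAt.comp_linearIsometryEquiv ofComplex.symm h1)
  · have h1 := (Complex.continuous_re.tendsto _).comp (hL _ (hmem' x hx))
    refine h1.congr fun n => ?_
    simp only [Function.comp]
    rw [hGre n _ (hsub (hmem' x hx)), LinearIsometryEquiv.apply_symm_apply]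
    congr 1
    abel

/-- The dipole field `⟨x, n⟩ / |x|²` is harmonic away from its pole. -/
theorem harmonicAt_dipole (n : Plane) {x : Plane} (hx : x ≠ 0) :
    HarmonicAt (fun y : Plane => inner ℝ y n / ‖y‖ ^ 2) x := by
  -- In complex notation the dipole field is Re(m/z).
  set m : ℂ := ofComplex.symm n
  have h : (fun y : Plane => inner ℝ y n / ‖y‖ ^ 2) =
      fun y => (fun z : ℂ => (m / z).re) (ofComplex.symm y) := by
    ext y
    have h1 : inner ℝ y n = inner ℝ (ofComplex.symm y) m :=
      (LinearIsometryEquiv.inner_map_map _ _ _).symm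
    have h2 : ‖y‖ = ‖ofComplex.symm y‖ := (LinearIsometryEquiv.norm_map _ _).symm
    rw [h1, h2]
    generalize ofComplex.symm y = z
    simp only [Complex.inner, Complex.div_re, ← Complex.normSq_eq_norm_sq]
    simp
    ring
  rw [h]
  refine HarmonicAt.comp_linearIsometryEquiv (f := fun z : ℂ => (m / z).re) ofComplex.symm ?_
  refine AnalyticAt.harmonicAt_re (f := fun z => m / z) ?_
  refine analyticAt_const.div analyticAt_id ?_
  exact (map_ne_zero_iff _ ofComplex.symm.injective).mpr hx

end BowTie

/-! ### The free dipole potential and its distributional equation -/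

namespace BowTie

open Topology InnerProductSpace Laplacian Metric

noncomputable abbrev e₀ : Plane := EuclideanSpace.single 0 1
noncomputable abbrev e₁ : Plane := EuclideanSpace.single 1 1

theorem laplacian_eq (f : Plane → ℝ) (x : Plane) :
    Δ f x = fderiv ℝ (fderiv ℝ f) x e₀ e₀ + fderiv ℝ (fderiv ℝ f) x e₁ e₁ := by
  rw [laplacian_eq_iteratedFDeriv_orthonormalBasis f (EuclideanSpace.basisFun (Fin 2) ℝ)]
  simp [Fin.sum_univ_two, iteratedFDeriv_two_apply]

/-- The potential of the unit dipole at the origin pointing in the direction of the second axis. -/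
noncomputable def dipole (x : Plane) : ℝ := (2 * Real.pi)⁻¹ * (x 1 / ‖x‖ ^ 2)

theorem dipole_eq : dipole = (2 * Real.pi)⁻¹ • fun x : Plane => inner ℝ x e₁ / ‖x‖ ^ 2 := by
  ext x
  simp [dipole, EuclideanSpace.inner_single_right]

theorem harmonicAt_dipole_potential {x : Plane} (hx : x ≠ 0) : HarmonicAt dipole x := by
  rw [dipole_eq]
  exact (harmonicAt_dipole e₁ hx).const_smul

theorem abs_apply_le_norm (x : Plane) (i : Fin 2) : |x i| ≤ ‖x‖ := PiLp.norm_apply_le x i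

theorem norm_dipole_le (x : Plane) : ‖dipole x‖ ≤ (2 * Real.pi)⁻¹ * ‖x‖⁻¹ := by
  rw [dipole, norm_mul, Real.norm_of_nonneg (by positivity)]
  gcongr
  rw [norm_div, Real.norm_eq_abs, norm_pow, norm_norm]
  rcases eq_or_ne x 0 with rfl | hx
  · simp
  have h0 : 0 < ‖x‖ := norm_pos_iff.mpr hx
  rw [div_le_iff₀ (by positivity)]
  calc |x 1| ≤ ‖x‖ := abs_apply_le_norm x 1
    _ = ‖x‖⁻¹ * ‖x‖ ^ 2 := by field_simp

theorem measurable_dipole : Measurable dipole := by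
  unfold dipole
  fun_prop

theorem locallyIntegrable_dipole : LocallyIntegrable dipole := by
  refine locallyIntegrable_of_norm_le_rpow (C := (2 * Real.pi)⁻¹) (α := 1) (by simp) (by simp)
    (Eventually.of_forall fun x => ?_) measurable_dipole.aestronglyMeasurable
  rw [Real.rpow_neg_one]
  exact norm_dipole_le x

/-- Polar coordinates in the Euclidean plane. -/
noncomputable def polarVec (t : ℝ) : Plane := Real.cos t • e₀ + Real.sin t • e₁

/-- The derivative of `polarVec`. -/
noncomputable def polarVec' (t : ℝ) : Plane := -Real.sin t • e₀ + Real.cos t • e₁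

theorem hasDerivAt_polarVec (t : ℝ) : HasDerivAt polarVec (polarVec' t) t :=
  ((Real.hasDerivAt_cos t).smul_const e₀).add ((Real.hasDerivAt_sin t).smul_const e₁)

theorem continuous_polarVec : Continuous polarVec := by unfold polarVec; fun_prop

theorem continuous_polarVec' : Continuous polarVec' := by unfold polarVec'; fun_prop

theorem norm_polarVec (t : ℝ) : ‖polarVec t‖ = 1 := by
  simp [polarVec, EuclideanSpace.norm_eq, Fin.sum_univ_two]

theorem integral_eq_integral_polar (f : Plane → ℝ) :
    ∫ x, f x = ∫ p in Ioi (0 : ℝ) ×ˢ Ioo (-Real.pi) Real.pi, p.1 * f (p.1 • polarVec p.2) := by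
  have h1 : ∫ x, f x = ∫ z, f (ofComplex z) :=
    ((ofComplex.measurePreserving).integral_comp
      ofComplex.toHomeomorph.measurableEmbedding f).symm
  rw [h1, ← Complex.integral_comp_polarCoord_symm, polarCoord_target]
  refine setIntegral_congr_fun (measurableSet_Ioi.prod measurableSet_Ioo) fun p _ => ?_
  simp only [smul_eq_mul]
  congr 2
  rw [Complex.polarCoord_symm_apply]
  ext i
  fin_cases i <;> simp [polarVec, -Complex.ofReal_cos, -Complex.ofReal_sin]

/-- The Jacobian r cancels the singularity, so the polar integrand extends continuously to r = 0. -/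
theorem dipole_polar {r t : ℝ} (hr : 0 < r) :
    r * dipole (r • polarVec t) = (2 * Real.pi)⁻¹ * Real.sin t := by
  rw [dipole, norm_smul, norm_polarVec, Real.norm_of_nonneg hr.le]
  simp [polarVec]
  field_simp

/-- The dipole potential solves `Δ N = ∂₂ δ₀` in the sense of distributions. -/
theorem integral_dipole_mul_laplacian {φ : Plane → ℝ} (hφ : ContDiff ℝ (⊤ : ℕ∞) φ)
    (hc : HasCompactSupport φ) :
    ∫ x, dipole x * Δ φ x = -(fderiv ℝ φ 0 e₁) := by
  set A := fderiv ℝ φ with hA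
  set D := fderiv ℝ A with hD
  have hA1 : ContDiff ℝ 1 A := hφ.fderiv_right (by norm_cast)
  have hDc : Continuous D := hA1.continuous_fderiv one_ne_zero
  have hAd : Differentiable ℝ A := hA1.differentiable one_ne_zero
  have hsymm : ∀ x v w, D x v w = D x w v := by
    intro x v w
    have h2 : ContDiffAt ℝ 2 φ x := (hφ.of_le (by norm_cast)).contDiffAt
    exact h2.isSymmSndFDerivAt (by simp) v w
  obtain ⟨R, hR0, hR⟩ := hc.isCompact.isBounded.exists_pos_norm_lt
  have hAz : ∀ x : Plane, R ≤ ‖x‖ → A x = 0 := by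
    intro x hx
    by_contra hne
    have : x ∈ tsupport φ := support_fderiv_subset ℝ hne
    exact absurd (hR x this) (not_lt.mpr hx)
  have hDz : ∀ x : Plane, R ≤ ‖x‖ → D x = 0 := by
    intro x hx
    by_contra hne
    have : x ∈ tsupport φ := tsupport_fderiv_subset ℝ (support_fderiv_subset ℝ hne)
    exact absurd (hR x this) (not_lt.mpr hx)
  -- Along a ray G₁ is the r-derivative of ∂₂φ, along a circle G₂ is 1/r times the θ-derivative of
  -- ∂₁φ, and sin θ · Δφ = G₁ − G₂. Thus both terms integrate explicitly.
  set G₁ : ℝ × ℝ → ℝ := fun p => D (p.1 • polarVec p.2) (polarVec p.2) e₁ with hG₁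
  set G₂ : ℝ × ℝ → ℝ := fun p => D (p.1 • polarVec p.2) (polarVec' p.2) e₀ with hG₂
  have hpv := continuous_polarVec
  have hpv' := continuous_polarVec'
  have hG₁c : Continuous G₁ := by fun_prop
  have hG₂c : Continuous G₂ := by fun_prop
  have hGint : ∀ G : ℝ × ℝ → ℝ, Continuous G →
      IntegrableOn G (Ioc 0 R ×ˢ Ioo (-Real.pi) Real.pi) := by
    intro G hG
    refine (hG.continuousOn.integrableOn_compact (isCompact_Icc.prod isCompact_Icc)).mono_set
      (prod_mono Ioc_subset_Icc_self Ioo_subset_Icc_self)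
  have hstep : ∫ x, dipole x * Δ φ x =
      ∫ p in Ioc (0 : ℝ) R ×ˢ Ioo (-Real.pi) Real.pi, (2 * Real.pi)⁻¹ * (G₁ p - G₂ p) := by
    rw [integral_eq_integral_polar]
    have hz : ∀ p ∈ (Ioi (0 : ℝ) ×ˢ Ioo (-Real.pi) Real.pi) \
        (Ioc (0 : ℝ) R ×ˢ Ioo (-Real.pi) Real.pi),
        p.1 * (dipole (p.1 • polarVec p.2) * Δ φ (p.1 • polarVec p.2)) = 0 := by
      rintro p ⟨⟨hp1, hp2⟩, hp⟩
      have hRp : R ≤ ‖p.1 • polarVec p.2‖ := by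
        rw [norm_smul, norm_polarVec, Real.norm_of_nonneg (le_of_lt hp1), mul_one]
        by_contra hlt
        exact hp ⟨⟨hp1, (not_le.mp hlt).le⟩, hp2⟩
      rw [laplacian_eq, ← hA, ← hD, hDz _ hRp]
      simp
    rw [setIntegral_eq_of_subset_of_forall_sdiff_eq_zero
      (measurableSet_Ioi.prod measurableSet_Ioo) (prod_mono Ioc_subset_Ioi_self le_rfl) hz]
    refine setIntegral_congr_fun (measurableSet_Ioc.prod measurableSet_Ioo) fun p hp => ?_
    rw [← mul_assoc, dipole_polar hp.1.1, laplacian_eq, ← hA, ← hD, hG₁, hG₂]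
    simp only [polarVec, polarVec', map_add, map_smul, _root_.add_apply,
      _root_.smul_apply, smul_eq_mul, neg_smul, map_neg,
      _root_.neg_apply]
    rw [hsymm _ e₀ e₁]
    ring
  -- Each ray contributes the value of −∂₂φ at the origin, and the rays have total angle 2π.
  have h1 : ∫ p in Ioc (0 : ℝ) R ×ˢ Ioo (-Real.pi) Real.pi, G₁ p = -(2 * Real.pi) * A 0 e₁ := by
    have hint := hGint G₁ hG₁c
    rw [Measure.volume_eq_prod] at hint ⊢
    rw [← Measure.prod_restrict, integral_prod_symm _
      (by rw [Measure.prod_restrict]; exact hint)]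
    have hinner : ∀ t : ℝ, ∫ r in Ioc (0 : ℝ) R, G₁ (r, t) = -(A 0 e₁) := by
      intro t
      rw [← intervalIntegral.integral_of_le hR0.le]
      have hd : ∀ r ∈ uIcc 0 R, HasDerivAt (fun r : ℝ => A (r • polarVec t) e₁) (G₁ (r, t)) r := by
        intro r _
        have h1 : HasDerivAt (fun r : ℝ => r • polarVec t) (polarVec t) r := by
          simpa using (hasDerivAt_id r).smul_const (polarVec t)
        have h2 := (hAd (r • polarVec t)).hasFDerivAt.comp_hasDerivAt r h1
        have h3 := h2.clm_apply (hasDerivAt_const r e₁)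
        simpa [hG₁] using h3
      rw [intervalIntegral.integral_eq_sub_of_hasDerivAt hd
        ((hG₁c.comp (by fun_prop : Continuous fun r : ℝ => (r, t))).intervalIntegrable _ _)]
      rw [hAz (R • polarVec t) (by
        rw [norm_smul, norm_polarVec, Real.norm_of_nonneg hR0.le, mul_one])]
      simp
    simp only [hinner, setIntegral_const]
    simp [Measure.real, Real.volume_Ioo]
    rw [ENNReal.toReal_ofReal (by positivity)]
    left
    ring
  -- Each circle contributes 0 by periodicity in θ.
  have h2 : ∫ p in Ioc (0 : ℝ) R ×ˢ Ioo (-Real.pi) Real.pi, G₂ p = 0 := by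
    have hint := hGint G₂ hG₂c
    rw [Measure.volume_eq_prod] at hint ⊢
    rw [setIntegral_prod _ hint]
    have hinner : ∀ r ∈ Ioc (0 : ℝ) R, ∫ t in Ioo (-Real.pi) Real.pi, G₂ (r, t) = 0 := by
      intro r hr
      rw [← integral_Ioc_eq_integral_Ioo, ← intervalIntegral.integral_of_le
        (by linarith [Real.pi_pos])]
      have hd : ∀ t ∈ uIcc (-Real.pi) Real.pi,
          HasDerivAt (fun t : ℝ => r⁻¹ * A (r • polarVec t) e₀) (G₂ (r, t)) t := by
        intro t _
        have h1 : HasDerivAt (fun t : ℝ => r • polarVec t) (r • polarVec' t) t :=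
          (hasDerivAt_polarVec t).const_smul r
        have h2 := (hAd (r • polarVec t)).hasFDerivAt.comp_hasDerivAt t h1
        have h3 := (h2.clm_apply (hasDerivAt_const t e₀)).const_mul r⁻¹
        have h4 : G₂ (r, t) = r⁻¹ * (fderiv ℝ A (r • polarVec t) (r • polarVec' t) e₀ +
            (A ∘ fun t => r • polarVec t) t 0) := by
          simp [hG₂, ← hD, inv_mul_cancel_left₀ hr.1.ne']
        rw [h4]
        exact h3
      rw [intervalIntegral.integral_eq_sub_of_hasDerivAt hd
        ((hG₂c.comp (by fun_prop : Continuous fun t : ℝ => (r, t))).intervalIntegrable _ _)]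
      simp [polarVec]
    rw [setIntegral_congr_fun measurableSet_Ioc hinner]
    simp
  rw [hstep, integral_const_mul, integral_sub (hGint G₁ hG₁c) (hGint G₂ hG₂c), h1, h2]
  field_simp
  ring

end BowTie

/-! ### Mollification and Weyl's lemma -/

namespace BowTie

open Topology InnerProductSpace Laplacian Metric ContinuousLinearMap
open scoped Convolution

theorem fderiv_convolution_apply {ψ g : Plane → ℝ} (hc : HasCompactSupport ψ)
    (hψ : ContDiff ℝ 1 ψ) (hg : LocallyIntegrable g) (v : Plane) :
    (fun x => fderiv ℝ (ψ ⋆[lsmul ℝ ℝ, volume] g) x v) =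
      ((fun x => fderiv ℝ ψ x v) ⋆[lsmul ℝ ℝ, volume] g) := by
  ext x
  rw [(hc.hasFDerivAt_convolution_left (lsmul ℝ ℝ) hψ hg x).fderiv]
  have hex : ConvolutionExistsAt (fderiv ℝ ψ) g x ((lsmul ℝ ℝ).precompL Plane) volume :=
    (hc.fderiv ℝ).convolutionExists_left _ (hψ.continuous_fderiv one_ne_zero) hg x
  rw [convolution_def, convolution_def, ContinuousLinearMap.integral_apply hex]
  rfl

theorem laplacian_eq_fderiv_apply {f : Plane → ℝ} (hf : ContDiff ℝ 2 f) (x : Plane) :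
    Δ f x = fderiv ℝ (fun y => fderiv ℝ f y e₀) x e₀ + fderiv ℝ (fun y => fderiv ℝ f y e₁) x e₁ := by
  have hd : DifferentiableAt ℝ (fderiv ℝ f) x :=
    ((hf.fderiv_right (m := 1) (by norm_num)).differentiable one_ne_zero).differentiableAt
  have h : ∀ v, fderiv ℝ (fun y => fderiv ℝ f y v) x v = fderiv ℝ (fderiv ℝ f) x v v := by
    intro v
    rw [fderiv_clm_apply hd (differentiableAt_const v)]
    simp
  rw [laplacian_eq, h, h]

/-- All derivatives fall on the mollifier, so the weak equation tested with its reflected translates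
becomes the pointwise harmonicity of the mollified function. -/
theorem laplacian_convolution {ψ g : Plane → ℝ} (hc : HasCompactSupport ψ)
    (hψ : ContDiff ℝ (⊤ : ℕ∞) ψ) (hg : LocallyIntegrable g) (x : Plane) :
    Δ (ψ ⋆[lsmul ℝ ℝ, volume] g) x = ∫ y, g y * Δ ψ (x - y) := by
  have hcd : ContDiff ℝ 2 (ψ ⋆[lsmul ℝ ℝ, volume] g) :=
    hc.contDiff_convolution_left (lsmul ℝ ℝ) (hψ.of_le (by norm_cast)) hg
  have hd : ∀ v : Plane, ContDiff ℝ (⊤ : ℕ∞) (fun x => fderiv ℝ ψ x v) := fun v =>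
    (hψ.fderiv_right (by norm_cast)).clm_apply contDiff_const
  have hdc : ∀ v : Plane, HasCompactSupport (fun x => fderiv ℝ ψ x v) := fun v =>
    hc.fderiv_apply ℝ v
  have h2 : ∀ v : Plane, fderiv ℝ (fun y => fderiv ℝ (ψ ⋆[lsmul ℝ ℝ, volume] g) y v) x v =
      ∫ y, fderiv ℝ (fun z => fderiv ℝ ψ z v) (x - y) v * g y := by
    intro v
    rw [fderiv_convolution_apply hc (hψ.of_le (by norm_cast)) hg v]
    have := congrFun (fderiv_convolution_apply (hdc v) ((hd v).of_le (by norm_cast)) hg v) x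
    rw [this, convolution_eq_swap]
    rfl
  have hint : ∀ v : Plane,
      Integrable (fun y => fderiv ℝ (fun z => fderiv ℝ ψ z v) (x - y) v * g y) := by
    intro v
    have hcs := (hdc v).fderiv_apply ℝ v
    have hct : Continuous fun y => fderiv ℝ (fun z => fderiv ℝ ψ z v) y v :=
      (((hd v).continuous_fderiv (by simp)).clm_apply continuous_const)
    have hcs' : HasCompactSupport fun y => fderiv ℝ (fun z => fderiv ℝ ψ z v) (x - y) v :=
      hcs.comp_homeomorph (Homeomorph.subLeft x)
    have := hg.integrable_smul_left_of_hasCompactSupport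
      (hct.comp (by fun_prop : Continuous fun y => x - y)) hcs'
    exact this
  rw [laplacian_eq_fderiv_apply hcd, h2, h2, ← integral_add (hint _) (hint _)]
  congr 1
  ext y
  rw [laplacian_eq_fderiv_apply (hψ.of_le (by norm_cast))]
  ring

theorem laplacian_comp_sub_left (f : Plane → ℝ) (x y : Plane) :
    Δ (fun z => f (x - z)) y = Δ f (x - y) := by
  have h : (fun z => f (x - z)) = fun z => (fun w => f (w + x)) (LinearIsometryEquiv.neg ℝ z) := by
    ext z
    simp [sub_eq_neg_add]
  rw [h, laplacian_comp_linearIsometryEquiv (fun w => f (w + x)) (LinearIsometryEquiv.neg ℝ) y,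
    laplacian_comp_add_right]
  simp [sub_eq_neg_add]

/-- Weyl's lemma for functions that are continuous except possibly at the center of a disk. -/
theorem exists_harmonic_of_weakly_harmonic {h : Plane → ℝ} {p : Plane} {R : ℝ} (hR : 0 < R)
    (hint : IntegrableOn h (closedBall p R)) (hcont : ContinuousOn h (closedBall p R \ {p}))
    (hweak : ∀ φ : Plane → ℝ, ContDiff ℝ (⊤ : ℕ∞) φ → HasCompactSupport φ →
      tsupport φ ⊆ closedBall p R → ∫ x, h x * Δ φ x = 0) :
    ∃ H : Plane → ℝ, HarmonicOnNhd H (ball p (R / 4)) ∧ ∀ x ∈ ball p (R / 4), x ≠ p → H x = h x := by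
  set g : Plane → ℝ := (closedBall p R).indicator h with hg
  have hgint : Integrable g := (integrable_indicator_iff measurableSet_closedBall).mpr hint
  have hgloc : LocallyIntegrable g := hgint.locallyIntegrable
  have hgm : AEStronglyMeasurable g volume := hgint.aestronglyMeasurable
  -- The outer radii are at most R/8, so a mollification at a point of the disk of radius 3R/4 only
  -- sees values in the disk of radius R.
  set b : ℕ → ContDiffBump (0 : Plane) := fun n =>
    { rIn := R / (8 * (n + 2)), rOut := R / (4 * (n + 2)), rIn_pos := by positivity,
      rIn_lt_rOut := by gcongr; norm_num } with hb
  have hrout : ∀ n, (b n).rOut ≤ R / 8 := by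
    intro n
    simp only [hb]
    gcongr
    have : (0 : ℝ) ≤ n := Nat.cast_nonneg n
    linarith
  have hrlim : Tendsto (fun n => (b n).rOut) atTop (𝓝 0) := by
    simp only [hb]
    refine Tendsto.div_atTop tendsto_const_nhds ?_
    refine Tendsto.const_mul_atTop (by norm_num) ?_
    exact tendsto_atTop_add_const_right _ _ tendsto_natCast_atTop_atTop
  set f : ℕ → Plane → ℝ := fun n => (b n).normed volume ⋆[lsmul ℝ ℝ, volume] g with hf
  have hbs : ∀ n, ContDiff ℝ (⊤ : ℕ∞) ((b n).normed volume) := fun n => (b n).contDiff_normed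
  have hbc : ∀ n, HasCompactSupport ((b n).normed volume) := fun n =>
    (b n).hasCompactSupport_normed
  have hfharm : ∀ n, HarmonicOnNhd (f n) (ball p (3 * R / 4)) := by
    have hlap : ∀ n, ∀ x ∈ ball p (3 * R / 4), Δ (f n) x = 0 := by
      intro n x hx
      simp only [hf]
      rw [laplacian_convolution (hbc n) (hbs n) hgloc]
      have hts : tsupport (fun y => (b n).normed volume (x - y)) ⊆ closedBall p R := by
        refine closure_minimal (fun y hy => ?_) isClosed_closedBall
        have hy' : x - y ∈ Function.support ((b n).normed volume) := hy
        rw [(b n).support_normed_eq, mem_ball_zero_iff, ← dist_eq_norm] at hy'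
        rw [mem_closedBall]
        have := dist_triangle_left y p x
        rw [mem_ball] at hx
        linarith [hrout n]
      have h1 := hweak (fun y => (b n).normed volume (x - y))
        ((hbs n).comp (contDiff_const.sub contDiff_id))
        ((hbc n).comp_homeomorph (Homeomorph.subLeft x)) hts
      rw [← h1]
      congr 1
      ext y
      rw [laplacian_comp_sub_left]
      by_cases hy : y ∈ closedBall p R
      · rw [hg, indicator_of_mem hy]
      · have hz : ∀ᶠ z in 𝓝 y, (fun y => (b n).normed volume (x - y)) z = (fun _ => 0) z := by
          have : y ∉ tsupport (fun y => (b n).normed volume (x - y)) := fun h => hy (hts h)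
          rw [notMem_tsupport_iff_eventuallyEq] at this
          exact this
        have := (laplacian_congr_nhds hz).self_of_nhds
        rw [laplacian_comp_sub_left] at this
        rw [this]
        simp
    intro n x hx
    refine ⟨?_, ?_⟩
    · exact ((hbc n).contDiff_convolution_left (n := 2) (lsmul ℝ ℝ)
        ((hbs n).of_le (by norm_cast)) hgloc).contDiffAt
    · filter_upwards [isOpen_ball.mem_nhds hx] with y hy using hlap n y hy
  have hclose : ∀ n, ∀ x, ∀ δ, (∀ y ∈ ball x (b n).rOut, dist (g y) (g x) ≤ δ) →
      dist (f n x) (g x) ≤ δ := fun n x δ hx =>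
    ContDiffBump.dist_normed_convolution_le hgm hx
  -- On this annulus h is uniformly continuous, since the exceptional point p is excluded. The
  -- mollifications therefore converge uniformly on the circle of radius R/2.
  set A : Set Plane := closedBall p (3 * R / 4) \ ball p (R / 4) with hA
  have hAc : IsCompact A := (isCompact_closedBall _ _).diff isOpen_ball
  have hgA : ContinuousOn g A := by
    have : ContinuousOn h A := hcont.mono (by
      rintro y ⟨hy1, hy2⟩
      refine ⟨closedBall_subset_closedBall (by linarith) hy1, ?_⟩
      rintro rfl
      exact hy2 (mem_ball_self (by positivity)))
    refine this.congr fun y hy => ?_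
    rw [hg, indicator_of_mem (closedBall_subset_closedBall (by linarith) hy.1)]
  have huc := hAc.uniformContinuousOn_of_continuous hgA
  have hsphere : ∀ δ > 0, ∃ N, ∀ n ≥ N, ∀ x ∈ sphere p (R / 2), dist (f n x) (g x) ≤ δ := by
    intro δ hδ
    obtain ⟨η, hη, hη'⟩ := Metric.uniformContinuousOn_iff.mp huc δ hδ
    obtain ⟨N, hN⟩ := eventually_atTop.mp (hrlim.eventually_lt_const hη)
    refine ⟨N, fun n hn x hx => hclose n x δ fun y hy => ?_⟩
    rw [mem_sphere] at hx
    rw [mem_ball] at hy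
    have hxA : x ∈ A := ⟨mem_closedBall.mpr (by linarith),
      fun h => by rw [mem_ball] at h; linarith⟩
    have h1 := dist_triangle y x p
    have h2 := dist_triangle_left x p y
    have hyA : y ∈ A := ⟨mem_closedBall.mpr (by linarith [hrout n]),
      fun h => by rw [mem_ball] at h; linarith [hrout n]⟩
    exact (hη' y hyA x hxA (hy.trans (hN n hn))).le
  -- The maximum principle carries the convergence from the circle into the disk, so nothing is
  -- needed about h at p.
  have hcauchy : UniformCauchySeqOn f atTop (ball p (R / 2)) := by
    rw [Metric.uniformCauchySeqOn_iff]
    intro δ hδ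
    obtain ⟨N, hN⟩ := hsphere (δ / 4) (by positivity)
    have hone : ∀ m ≥ N, ∀ n ≥ N, ∀ x ∈ ball p (R / 2), f m x - f n x ≤ δ / 2 := by
      intro m hm n hn x hx
      have hh : ∀ k, HarmonicOnNhd (f k) (closedBall p (R / 2)) := fun k =>
        (hfharm k).mono (closedBall_subset_ball (by linarith))
      have hd : HarmonicOnNhd (f m - f n - fun _ => δ / 2) (closedBall p (R / 2)) :=
        ((hh m).sub (hh n)).sub (harmonicOnNhd_const _)
      have := le_zero_of_harmonicOnNhd_of_isBounded isOpen_ball isBounded_ball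
        (hd.mono ball_subset_closedBall) (hd.continuousOn.mono closure_ball_subset_closedBall)
        (fun y hy => by
          have hy' : y ∈ sphere p (R / 2) := frontier_ball_subset_sphere hy
          have h1 := hN m hm y hy'
          have h2 := hN n hn y hy'
          rw [Real.dist_eq, abs_le] at h1 h2
          simp only [Pi.sub_apply]
          linarith) x hx
      simp only [Pi.sub_apply] at this
      linarith
    refine ⟨N, fun m hm n hn x hx => ?_⟩
    rw [Real.dist_eq, abs_lt]
    constructor <;> linarith [hone m hm n hn x hx, hone n hn m hm x hx]
  obtain ⟨H, hH, hlim⟩ := exists_harmonic_limit (by positivity)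
    (fun n => (hfharm n).mono (ball_subset_ball (by linarith))) hcauchy
  have hR4 : R / 2 / 2 = R / 4 := by ring
  rw [hR4] at hH hlim
  refine ⟨H, hH, fun x hx hxp => ?_⟩
  have hxR : x ∈ ball p R := ball_subset_ball (by linarith) hx
  have hnhds : closedBall p R \ {p} ∈ 𝓝 x := by
    refine inter_mem (mem_of_superset (isOpen_ball.mem_nhds hxR) ball_subset_closedBall) ?_
    exact isOpen_compl_singleton.mem_nhds hxp
  have hgx : ContinuousAt g x := by
    refine (hcont.continuousAt hnhds).congr ?_
    filter_upwards [hnhds] with y hy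
    rw [hg, indicator_of_mem hy.1]
  have hlim2 : Tendsto (fun n => f n x) atTop (𝓝 (g x)) :=
    ContDiffBump.convolution_tendsto_right hrlim (Eventually.of_forall fun _ => hgm)
      (hgx.tendsto.comp tendsto_snd) tendsto_const_nhds
  rw [tendsto_nhds_unique (hlim x hx) hlim2, hg,
    indicator_of_mem (ball_subset_closedBall hxR)]

end BowTie

/-! ### Inward normals and the zero flux condition -/

namespace BowTie

open Topology InnerProductSpace Laplacian Metric

theorem _root_.IsLocalDefiningFunction.eq_zero {Ω U : Set Plane} {x : Plane} {f : Plane → ℝ}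
    (h : IsLocalDefiningFunction Ω x U f) (hx : x ∈ frontier Ω) : f x = 0 := by
  have hU : U ∈ 𝓝 x := h.isOpen.mem_nhds h.mem
  have hc : ContinuousAt f x := h.smooth.continuousOn.continuousAt hU
  have hmem : ∀ y ∈ U, (y ∈ Ω ↔ f y < 0) := by
    intro y hy
    have := Set.ext_iff.mp h.inter_eq y
    simpa [hy] using this
  rw [frontier_eq_closure_inter_closure] at hx
  by_contra hne
  rcases lt_or_gt_of_ne hne with hlt | hgt
  · have hev := (hc.eventually_lt_const hlt).and hU
    obtain ⟨y, hy, hy'⟩ := ((mem_closure_iff_frequently.mp hx.2).and_eventually hev).exists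
    exact hy ((hmem y hy'.2).mpr hy'.1)
  · have hev := (hc.eventually_const_lt hgt).and hU
    obtain ⟨y, hy, hy'⟩ := ((mem_closure_iff_frequently.mp hx.1).and_eventually hev).exists
    exact absurd ((hmem y hy'.2).mp hy) (not_lt.mpr hy'.1.le)

theorem eventually_mul_pos_of_hasDerivAt {k : ℝ → ℝ} {a : ℝ} (hk : HasDerivAt k a 0)
    (h0 : k 0 = 0) (ha : 0 < a) : ∀ᶠ t in 𝓝[>] (0 : ℝ), 0 < k t := by
  have h1 := (hasDerivAt_iff_tendsto_slope.mp hk).mono_left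
    (nhdsWithin_mono 0 (fun t (ht : t ∈ Ioi (0 : ℝ)) => ne_of_gt ht))
  filter_upwards [h1.eventually_const_lt ha, self_mem_nhdsWithin] with t ht ht0
  rw [slope_def_field, h0, sub_zero, sub_zero] at ht
  exact (div_pos_iff_of_pos_right ht0).mp ht

theorem _root_.IsInwardUnitNormal.exists_hasDerivAt {Ω : Set Plane} {x n : Plane}
    (h : IsInwardUnitNormal Ω x n) (hx : x ∈ frontier Ω) :
    ∃ f : Plane → ℝ, ∃ c > 0, f x = 0 ∧ (∀ᶠ y in 𝓝 x, (y ∈ Ω ↔ f y < 0)) ∧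
      ∀ w : Plane, HasDerivAt (fun t : ℝ => f (x + t • w)) (-(c * inner ℝ n w)) 0 := by
  obtain ⟨-, U, f, hf, hn⟩ := h
  have hU : U ∈ 𝓝 x := hf.isOpen.mem_nhds hf.mem
  refine ⟨f, ‖fderiv ℝ f x‖, norm_pos_iff.mpr (hf.fderiv_ne_zero x hf.mem), hf.eq_zero hx, ?_,
    fun w => ?_⟩
  · filter_upwards [hU] with y hy
    have := Set.ext_iff.mp hf.inter_eq y
    simpa [hy] using this
  · rw [← hn w]
    have hd : DifferentiableAt ℝ f x :=
      (hf.smooth.contDiffAt hU).differentiableAt (by simp)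
    have hl : HasDerivAt (fun t : ℝ => x + t • w) w 0 := by
      simpa using ((hasDerivAt_id (0 : ℝ)).smul_const w).const_add x
    have hd' : HasFDerivAt f (fderiv ℝ f x) (x + (0 : ℝ) • w) := by
      simpa using hd.hasFDerivAt
    exact hd'.comp_hasDerivAt (0 : ℝ) hl

theorem tendsto_add_smul (x w : Plane) : Tendsto (fun t : ℝ => x + t • w) (𝓝[>] 0) (𝓝 x) := by
  have : ContinuousAt (fun t : ℝ => x + t • w) 0 := by fun_prop
  have h2 : Tendsto (fun t : ℝ => x + t • w) (𝓝 0) (𝓝 x) := by simpa [ContinuousAt] using this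
  exact h2.mono_left nhdsWithin_le_nhds

theorem _root_.IsInwardUnitNormal.eventually_mem {Ω : Set Plane} {x n w : Plane}
    (h : IsInwardUnitNormal Ω x n) (hx : x ∈ frontier Ω) (hw : 0 < inner ℝ n w) :
    ∀ᶠ t in 𝓝[>] (0 : ℝ), x + t • w ∈ Ω := by
  obtain ⟨f, c, hc, h0, hmem, hd⟩ := h.exists_hasDerivAt hx
  have h1 := eventually_mul_pos_of_hasDerivAt (hd w).neg (by simp [h0])
    (by rw [neg_neg]; positivity)
  filter_upwards [h1, (tendsto_add_smul x w).eventually hmem] with t ht hm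
  exact hm.mpr (by simpa using ht)

theorem _root_.IsInwardUnitNormal.eventually_notMem {Ω : Set Plane} {x n w : Plane}
    (h : IsInwardUnitNormal Ω x n) (hx : x ∈ frontier Ω) (hw : inner ℝ n w < 0) :
    ∀ᶠ t in 𝓝[>] (0 : ℝ), x + t • w ∉ Ω := by
  obtain ⟨f, c, hc, h0, hmem, hd⟩ := h.exists_hasDerivAt hx
  have h1 := eventually_mul_pos_of_hasDerivAt (hd w) (by simp [h0]) (by nlinarith)
  filter_upwards [h1, (tendsto_add_smul x w).eventually hmem] with t ht hm
  rw [hm]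
  exact not_lt.mpr ht.le

/-- If n ≠ m, the direction n − m has positive product with n and negative product with m, so it
would both enter and avoid Ω. This makes the normal independent of the defining function and
identifies it on a straight edge without constructing one. -/
theorem _root_.IsInwardUnitNormal.eq_of_eventually_notMem {Ω : Set Plane} {x n m : Plane}
    (h : IsInwardUnitNormal Ω x n) (hx : x ∈ frontier Ω) (hm : ‖m‖ = 1)
    (hout : ∀ w : Plane, inner ℝ m w < 0 → ∀ᶠ t in 𝓝[>] (0 : ℝ), x + t • w ∉ Ω) : n = m := by
  by_contra hne
  have hn : ‖n‖ = 1 := h.1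
  have hlt : inner ℝ n m < (1 : ℝ) := (inner_lt_one_iff_real_of_norm_eq_one hn hm).mpr hne
  have h1 := h.eventually_mem hx (w := n - m) (by
    rw [inner_sub_right, real_inner_self_eq_norm_sq, hn]; linarith)
  have h2 := hout (n - m) (by
    rw [inner_sub_right, real_inner_self_eq_norm_sq, hm, real_inner_comm]; linarith)
  obtain ⟨t, ht, ht'⟩ := (h1.and h2).exists
  exact ht' ht

theorem _root_.IsInwardUnitNormal.unique {Ω : Set Plane} {x n m : Plane}
    (hn : IsInwardUnitNormal Ω x n) (hm : IsInwardUnitNormal Ω x m) (hx : x ∈ frontier Ω) :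
    n = m :=
  hn.eq_of_eventually_notMem hx hm.1 fun _ hw => hm.eventually_notMem hx hw

theorem _root_.IsLocalDefiningFunction.comp {Ω U : Set Plane} {x : Plane} {f : Plane → ℝ}
    (e : Plane ≃ₗᵢ[ℝ] Plane) (h : IsLocalDefiningFunction Ω (e x) U f) :
    IsLocalDefiningFunction (e ⁻¹' Ω) x (e ⁻¹' U) (fun y => f (e y)) where
  isOpen := h.isOpen.preimage e.continuous
  mem := h.mem
  smooth := h.smooth.comp (e.toContinuousLinearEquiv.contDiff.contDiffOn) (fun _ hy => hy)
  fderiv_ne_zero := by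
    intro y hy h0
    refine h.fderiv_ne_zero (e y) hy ?_
    have h1 : fderiv ℝ (fun y => f (e y)) y =
        (fderiv ℝ f (e y)).comp (e.toContinuousLinearEquiv : Plane →L[ℝ] Plane) :=
      e.toContinuousLinearEquiv.comp_right_fderiv (f := f) (x := y)
    ext w
    have h2 := congrArg (fun L => L (e.symm w)) (h1.symm.trans h0)
    simpa using h2
  inter_eq := by
    ext y
    have := Set.ext_iff.mp h.inter_eq (e y)
    simpa using this

theorem _root_.IsInwardUnitNormal.comp {Ω : Set Plane} {x n : Plane} (e : Plane ≃ₗᵢ[ℝ] Plane)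
    (h : IsInwardUnitNormal Ω (e x) n) : IsInwardUnitNormal (e ⁻¹' Ω) x (e.symm n) := by
  obtain ⟨hn, U, f, hf, hfn⟩ := h
  have h1 : fderiv ℝ (fun y => f (e y)) x =
      (fderiv ℝ f (e x)).comp (e.toContinuousLinearEquiv : Plane →L[ℝ] Plane) :=
    e.toContinuousLinearEquiv.comp_right_fderiv (f := f) (x := x)
  have h2 : ‖fderiv ℝ (fun y => f (e y)) x‖ = ‖fderiv ℝ f (e x)‖ := by
    rw [h1]
    exact ContinuousLinearMap.opNorm_comp_linearIsometryEquiv _ e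
  refine ⟨by rw [LinearIsometryEquiv.norm_map, hn], _, _, hf.comp e, fun w => ?_⟩
  rw [h2, h1]
  have h3 : inner ℝ (e.symm n) w = inner ℝ n (e w) := by
    rw [← e.inner_map_map, LinearIsometryEquiv.apply_symm_apply]
  rw [h3]
  exact hfn (e w)

theorem _root_.HasZeroFlux.comp {Ω : Set Plane} {V : Plane} {u : Plane → ℝ} (e : Plane ≃ₗᵢ[ℝ] Plane)
    (h : HasZeroFlux Ω V u) : HasZeroFlux (e ⁻¹' Ω) (e.symm V) (fun x => u (e x)) := by
  obtain ⟨g, hg, hint, h0⟩ := h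
  have hfr : frontier (e ⁻¹' Ω) = e ⁻¹' frontier Ω := (e.toHomeomorph.preimage_frontier Ω).symm
  have hmp := e.toIsometryEquiv.measurePreserving_hausdorffMeasure 1
  have hme : MeasurableEmbedding e.toIsometryEquiv :=
    e.toHomeomorph.measurableEmbedding
  refine ⟨fun x => g (e x), fun x hx hxV => ?_, ?_, ?_⟩
  · rw [hfr] at hx
    obtain ⟨n, hn, hd⟩ := hg (e x) hx (fun heq => hxV (by rw [← heq]; simp))
    refine ⟨e.symm n, hn.comp e, ?_⟩
    simpa using hd
  · rw [hfr]
    exact (hmp.integrableOn_comp_preimage hme).mpr hint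
  · rw [hfr]
    exact (hmp.setIntegral_preimage_emb hme g (frontier Ω)).trans h0

/-- The two conditions provide their normals separately; uniqueness of the normal is what allows the
derivatives to be added. -/
theorem _root_.HasZeroFlux.add {Ω : Set Plane} {V : Plane} {u v : Plane → ℝ}
    (hu : HasZeroFlux Ω V u) (hv : HasZeroFlux Ω V v) :
    HasZeroFlux Ω V (fun x => u x + v x) := by
  obtain ⟨g, hg, hgi, hg0⟩ := hu
  obtain ⟨k, hk, hki, hk0⟩ := hv
  refine ⟨fun x => g x + k x, fun x hx hxV => ?_, hgi.add hki, ?_⟩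
  · obtain ⟨n, hn, hd⟩ := hg x hx hxV
    obtain ⟨m, hm, hd'⟩ := hk x hx hxV
    obtain rfl := hn.unique hm hx
    exact ⟨n, hn, hd.add hd'⟩
  · rw [integral_add hgi hki, hg0, hk0, add_zero]

theorem _root_.HasZeroFlux.neg {Ω : Set Plane} {V : Plane} {u : Plane → ℝ}
    (hu : HasZeroFlux Ω V u) : HasZeroFlux Ω V (fun x => -u x) := by
  obtain ⟨g, hg, hgi, hg0⟩ := hu
  refine ⟨fun x => -g x, fun x hx hxV => ?_, hgi.neg, ?_⟩
  · obtain ⟨n, hn, hd⟩ := hg x hx hxV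
    exact ⟨n, hn, hd.neg⟩
  · rw [integral_neg, hg0, neg_zero]

theorem _root_.HasZeroFlux.congr {Ω : Set Plane} {V : Plane} {u v : Plane → ℝ}
    (hu : HasZeroFlux Ω V u) (huv : ∀ x ∈ frontier Ω, ∀ᶠ y in 𝓝 x, v y = u y) :
    HasZeroFlux Ω V v := by
  obtain ⟨g, hg, hgi, hg0⟩ := hu
  refine ⟨g, fun x hx hxV => ?_, hgi, hg0⟩
  obtain ⟨n, hn, hd⟩ := hg x hx hxV
  refine ⟨n, hn, hd.congr_of_eventuallyEq ?_ ?_⟩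
  · have hc : ContinuousAt (fun t : ℝ => x + t • n) 0 := by fun_prop
    have h2 : Tendsto (fun t : ℝ => x + t • n) (𝓝 0) (𝓝 x) := by simpa [ContinuousAt] using hc
    exact (h2.mono_left nhdsWithin_le_nhds).eventually (huv x hx)
  · simpa using (huv x hx).self_of_nhds

theorem le_of_hasDerivWithinAt_Iic {k : ℝ → ℝ} {a c : ℝ} (hk : HasDerivWithinAt k a (Iic 0) 0)
    (h : ∀ᶠ t in 𝓝[>] (0 : ℝ), k (-t) ≤ k 0 - c * t) : c ≤ a := by
  have h1 : HasDerivWithinAt k a (Iio 0) 0 := hk.mono Iio_subset_Iic_self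
  have h2 := (hasDerivWithinAt_iff_tendsto_slope' (self_notMem_Iio)).mp h1
  have hneg : Tendsto (fun t : ℝ => -t) (𝓝[<] 0) (𝓝[>] 0) := by
    simpa using tendsto_neg_nhdsLT (a := (0 : ℝ))
  refine ge_of_tendsto h2 ?_
  filter_upwards [hneg.eventually h, self_mem_nhdsWithin] with t ht ht0
  rw [neg_neg] at ht
  have ht0' : t < 0 := ht0
  rw [slope_def_field, sub_zero, le_div_iff_of_neg ht0']
  linarith

/-- A function that attains its maximum on the boundary of an inclusion has nonzero flux if it
satisfies Hopf's boundary point lemma along some segment of the boundary. -/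
theorem not_hasZeroFlux {Ω : Set Plane} {V P Q : Plane} {w : Plane → ℝ} {M : ℝ}
    (hM : ∀ x ∈ frontier Ω, w x = M)
    (hle : ∀ x ∈ frontier Ω, ∀ᶠ y in 𝓝 x, y ∉ Ω → w y ≤ M) (hPQ : P ≠ Q)
    (hseg : ∀ x ∈ segment ℝ P Q, x ∈ frontier Ω ∧ x ≠ V ∧ ∃ m : Plane, ‖m‖ = 1 ∧
      (∀ z : Plane, inner ℝ m z < 0 → ∀ᶠ t in 𝓝[>] (0 : ℝ), x + t • z ∉ Ω) ∧
      ∃ c > 0, ∀ᶠ t in 𝓝[>] (0 : ℝ), w (x - t • m) ≤ M - c * t) :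
    ¬ HasZeroFlux Ω V w := by
  rintro ⟨g, hg, hgi, hg0⟩
  -- Just outside Ω the function is at most its boundary value M, so it does not decrease along the
  -- inward normal.
  have hnn : ∀ x ∈ frontier Ω, x ≠ V → 0 ≤ g x := by
    intro x hx hxV
    obtain ⟨n, hn, hd⟩ := hg x hx hxV
    refine le_of_hasDerivWithinAt_Iic hd ?_
    have h1 := hn.eventually_notMem hx (w := -n) (by
      rw [inner_neg_right, real_inner_self_eq_norm_sq, hn.1]; norm_num)
    filter_upwards [h1, (tendsto_add_smul x (-n)).eventually (hle x hx)] with t ht ht'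
    simp only [zero_smul, add_zero, zero_mul, sub_zero, hM x hx, neg_smul]
    simpa using ht' ht
  have hpos : ∀ x ∈ segment ℝ P Q, 0 < g x := by
    intro x hx
    obtain ⟨hxf, hxV, m, hm, hout, c, hc, hw⟩ := hseg x hx
    obtain ⟨n, hn, hd⟩ := hg x hxf hxV
    obtain rfl := hn.eq_of_eventually_notMem hxf hm hout
    refine hc.trans_le (le_of_hasDerivWithinAt_Iic hd ?_)
    filter_upwards [hw] with t ht
    simpa [hM x hxf, sub_eq_add_neg] using ht
  set μ := (Measure.hausdorffMeasure (1 : ℝ) : Measure Plane)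
  have : NullSingletonClass μ := Measure.nullSingletonClass_hausdorff Plane one_pos
  have hmeas : MeasurableSet (frontier Ω) := isClosed_frontier.measurableSet
  have hae : ∀ᵐ x ∂(μ.restrict (frontier Ω)), 0 ≤ g x := by
    rw [ae_restrict_iff' hmeas]
    have hV : ∀ᵐ x ∂μ, x ≠ V := by
      simp [ae_iff, measure_singleton]
    filter_upwards [hV] with x hx hxf using hnn x hxf hx
  -- A nonnegative density with zero integral vanishes almost everywhere, yet it is positive on a
  -- segment whose one-dimensional measure is |P − Q| > 0. The vertex is a null set.
  have hzero := (setIntegral_eq_zero_iff_of_nonneg_ae hae hgi).mp hg0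
  have hz : (μ.restrict (frontier Ω)) (segment ℝ P Q) = 0 := by
    refine measure_mono_null (fun x hx => ?_) (ae_iff.mp hzero)
    exact (hpos x hx).ne'
  rw [Measure.restrict_eq_self _ (fun x hx => (hseg x hx).1), hausdorffMeasure_segment] at hz
  exact hPQ (edist_eq_zero.mp hz)

end BowTie

/-! ### Reflections and geometry of the two inclusions -/

namespace BowTie

open Topology InnerProductSpace Laplacian Metric

/-- The reflection of the plane that changes the sign of the `i`-th coordinate. -/
noncomputable def reflect (i : Fin 2) : Plane ≃ₗᵢ[ℝ] Plane :=
  LinearIsometryEquiv.piLpCongrRight 2 fun j =>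
    if j = i then LinearIsometryEquiv.neg ℝ else LinearIsometryEquiv.refl ℝ ℝ

theorem reflect_apply (i j : Fin 2) (x : Plane) : reflect i x j = if j = i then -x j else x j := by
  by_cases h : j = i <;> simp [reflect, h]

@[simp] theorem reflect_zero_zero (x : Plane) : reflect 0 x 0 = -x 0 := by simp [reflect_apply]
@[simp] theorem reflect_zero_one (x : Plane) : reflect 0 x 1 = x 1 := by simp [reflect_apply]
@[simp] theorem reflect_one_zero (x : Plane) : reflect 1 x 0 = x 0 := by simp [reflect_apply]
@[simp] theorem reflect_one_one (x : Plane) : reflect 1 x 1 = -x 1 := by simp [reflect_apply]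

theorem plane_ext {x y : Plane} (h0 : x 0 = y 0) (h1 : x 1 = y 1) : x = y := by
  ext i; fin_cases i <;> assumption

@[simp] theorem reflect_reflect (i : Fin 2) (x : Plane) : reflect i (reflect i x) = x := by
  ext j; simp only [reflect_apply]; split_ifs <;> simp

theorem reflect_symm_apply (i : Fin 2) (x : Plane) : (reflect i).symm x = reflect i x := by
  rw [LinearIsometryEquiv.symm_apply_eq, reflect_reflect]

/-- The exterior of the two inclusions. -/
def exteriorDomain (D : Set Plane) (ε : ℝ) : Set Plane :=
  (closure (inclusionLeft D ε ∪ inclusionRight D ε))ᶜ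

/-- The complement of the two inclusions. -/
def exteriorSet (D : Set Plane) (ε : ℝ) : Set Plane :=
  (inclusionLeft D ε ∪ inclusionRight D ε)ᶜ

section Geometry

variable {α μ ε : ℝ} {D : Set Plane}

theorem inclusionLeft_eq (D : Set Plane) (ε : ℝ) :
    inclusionLeft D ε = reflect 0 ⁻¹' inclusionRight D ε := by
  ext x
  have : !₂[-x 0, x 1] = reflect 0 x := plane_ext (by simp) (by simp)
  simp [inclusionLeft, this]

theorem reflect_zero_preimage_left (D : Set Plane) (ε : ℝ) :
    reflect 0 ⁻¹' inclusionLeft D ε = inclusionRight D ε := by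
  ext x; simp [inclusionLeft_eq]

theorem reflect_one_preimage_right (hD : IsInclusionShape α μ D) (ε : ℝ) :
    reflect 1 ⁻¹' inclusionRight D ε = inclusionRight D ε := by
  ext x
  have := hD.symm (x - vertexRight ε)
  have h : reflect 1 x - vertexRight ε =
      !₂[(x - vertexRight ε) 0, -(x - vertexRight ε) 1] :=
    plane_ext (by simp [vertexRight]) (by simp [vertexRight])
  simp only [mem_preimage, inclusionRight, mem_ofPred_eq, h]
  exact this.symm

theorem reflect_one_preimage_left (hD : IsInclusionShape α μ D) (ε : ℝ) :
    reflect 1 ⁻¹' inclusionLeft D ε = inclusionLeft D ε := by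
  have hcomm : ∀ x, reflect 0 (reflect 1 x) = reflect 1 (reflect 0 x) := fun x =>
    plane_ext (by simp) (by simp)
  ext x
  have := Set.ext_iff.mp (reflect_one_preimage_right hD ε) (reflect 0 x)
  simpa [inclusionLeft_eq, hcomm] using this

theorem isOpen_inclusionRight (hD : IsInclusionShape α μ D) : IsOpen (inclusionRight D ε) :=
  hD.isOpen.preimage (continuous_id.sub continuous_const)

theorem isOpen_inclusionLeft (hD : IsInclusionShape α μ D) : IsOpen (inclusionLeft D ε) := by
  rw [inclusionLeft_eq]
  exact (isOpen_inclusionRight hD).preimage (reflect 0).continuous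

theorem lt_of_mem_inclusionRight (hD : IsInclusionShape α μ D) {x : Plane}
    (hx : x ∈ inclusionRight D ε) : ε / 2 < x 0 := by
  have := hD.subset_rightHalfPlane _ hx
  simp [vertexRight] at this
  exact this

theorem lt_of_mem_inclusionLeft (hD : IsInclusionShape α μ D) {x : Plane}
    (hx : x ∈ inclusionLeft D ε) : x 0 < -(ε / 2) := by
  rw [inclusionLeft_eq] at hx
  have := lt_of_mem_inclusionRight hD hx
  simp at this
  linarith

theorem isClosed_exteriorSet (hD : IsInclusionShape α μ D) : IsClosed (exteriorSet D ε) :=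
  ((isOpen_inclusionLeft hD).union (isOpen_inclusionRight hD)).isClosed_compl

theorem isOpen_exteriorDomain : IsOpen (exteriorDomain D ε) := isClosed_closure.isOpen_compl

theorem exteriorDomain_subset : exteriorDomain D ε ⊆ exteriorSet D ε :=
  compl_subset_compl.mpr subset_closure

theorem closure_exteriorDomain_subset (hD : IsInclusionShape α μ D) :
    closure (exteriorDomain D ε) ⊆ exteriorSet D ε :=
  closure_minimal exteriorDomain_subset (isClosed_exteriorSet hD)

theorem reflect_mem_exteriorSet (hD : IsInclusionShape α μ D) (i : Fin 2) {x : Plane}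
    (hx : x ∈ exteriorSet D ε) : reflect i x ∈ exteriorSet D ε := by
  have h : reflect i ⁻¹' (inclusionLeft D ε ∪ inclusionRight D ε) =
      inclusionLeft D ε ∪ inclusionRight D ε := by
    rw [preimage_union]
    fin_cases i
    · simp only [Fin.zero_eta, reflect_zero_preimage_left, ← inclusionLeft_eq, union_comm]
    · simp only [Fin.mk_one, reflect_one_preimage_left hD, reflect_one_preimage_right hD]
  intro hmem
  exact hx (h ▸ hmem)

/-- An open set disjoint from the inclusions is disjoint from their closure. Membership in the
exterior can thus be tested against the open inclusions alone. -/
theorem mem_exteriorDomain_of_isOpen {U : Set Plane} (hU : IsOpen U)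
    (hUs : U ⊆ exteriorSet D ε) : U ⊆ exteriorDomain D ε := by
  have hdis : Disjoint U (inclusionLeft D ε ∪ inclusionRight D ε) :=
    disjoint_left.mpr fun y hy hy' => hUs hy hy'
  exact fun y hy hy' => disjoint_left.mp (hdis.closure_right hU) hy hy'

theorem reflect_mem_exteriorDomain (hD : IsInclusionShape α μ D) (i : Fin 2) {x : Plane}
    (hx : x ∈ exteriorDomain D ε) : reflect i x ∈ exteriorDomain D ε := by
  refine mem_exteriorDomain_of_isOpen
    (isOpen_exteriorDomain.preimage (reflect i).continuous) (fun y hy => ?_)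
    (show reflect i (reflect i x) ∈ exteriorDomain D ε by rwa [reflect_reflect])
  have := reflect_mem_exteriorSet hD i (exteriorDomain_subset hy)
  rwa [reflect_reflect] at this

theorem mem_exteriorSet_iff_cases (hD : IsInclusionShape α μ D) {x : Plane}
    (hx : x ∈ exteriorSet D ε) : x ∈ exteriorDomain D ε ∨ x ∈ frontier (inclusionLeft D ε) ∨
      x ∈ frontier (inclusionRight D ε) := by
  by_cases h : x ∈ closure (inclusionLeft D ε ∪ inclusionRight D ε)
  · right
    rw [closure_union] at h
    rw [(isOpen_inclusionLeft hD).frontier_eq, (isOpen_inclusionRight hD).frontier_eq]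
    exact h.imp (fun h => ⟨h, fun h' => hx (Or.inl h')⟩) (fun h => ⟨h, fun h' => hx (Or.inr h')⟩)
  · exact Or.inl h

theorem frontier_inclusionRight_subset (hD : IsInclusionShape α μ D) (hε : 0 < ε) {x : Plane}
    (hx : x ∈ frontier (inclusionRight D ε)) : ε / 2 ≤ x 0 ∧ x ∈ exteriorSet D ε := by
  rw [(isOpen_inclusionRight hD).frontier_eq] at hx
  have h0 : ε / 2 ≤ x 0 := by
    have hcl : closure (inclusionRight D ε) ⊆ {x : Plane | ε / 2 ≤ x 0} :=
      closure_minimal (fun y hy => (lt_of_mem_inclusionRight hD hy).le)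
        (isClosed_le continuous_const (by fun_prop))
    exact hcl hx.1
  refine ⟨h0, fun h => ?_⟩
  rcases h with h | h
  · have := lt_of_mem_inclusionLeft hD h
    linarith
  · exact hx.2 h

theorem frontier_inclusionLeft (D : Set Plane) (ε : ℝ) :
    frontier (inclusionLeft D ε) = reflect 0 ⁻¹' frontier (inclusionRight D ε) := by
  rw [inclusionLeft_eq]
  exact ((reflect 0).toHomeomorph.preimage_frontier _).symm

theorem frontier_inclusionLeft_subset (hD : IsInclusionShape α μ D) (hε : 0 < ε) {x : Plane}
    (hx : x ∈ frontier (inclusionLeft D ε)) : x 0 ≤ -(ε / 2) ∧ x ∈ exteriorSet D ε := by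
  rw [frontier_inclusionLeft] at hx
  have := frontier_inclusionRight_subset hD hε hx
  have h2 := reflect_mem_exteriorSet hD 0 this.2
  rw [reflect_reflect] at h2
  refine ⟨?_, h2⟩
  have := this.1
  simp at this
  linarith

theorem frontier_exteriorDomain_subset (hD : IsInclusionShape α μ D) {x : Plane}
    (hx : x ∈ frontier (exteriorDomain D ε)) : x ∈ frontier (inclusionLeft D ε) ∨
      x ∈ frontier (inclusionRight D ε) := by
  rw [isOpen_exteriorDomain.frontier_eq] at hx
  exact (mem_exteriorSet_iff_cases hD (closure_exteriorDomain_subset hD hx.1)).resolve_left hx.2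

theorem strip_subset_exteriorDomain (hD : IsInclusionShape α μ D) :
    {x : Plane | |x 0| < ε / 2} ⊆ exteriorDomain D ε := by
  refine mem_exteriorDomain_of_isOpen (isOpen_lt (by fun_prop) continuous_const) fun x hx h => ?_
  have hx' := abs_lt.mp (show |x 0| < ε / 2 from hx)
  rcases h with h | h
  · have := lt_of_mem_inclusionLeft hD h
    linarith [hx'.1]
  · have := lt_of_mem_inclusionRight hD h
    linarith [hx'.2]

/-- The unit normal of the upper edge of the right cone that points out of the cone. -/
noncomputable def edgeNormal (a : ℝ) : Plane := !₂[-Real.sin a, Real.cos a]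

/-- The unit tangent of the upper edge of the right cone. -/
noncomputable def edgeTangent (a : ℝ) : Plane := !₂[Real.cos a, Real.sin a]

theorem norm_edgeNormal (a : ℝ) : ‖edgeNormal a‖ = 1 := by
  simp [edgeNormal, EuclideanSpace.norm_eq, Fin.sum_univ_two]

theorem norm_edgeTangent (a : ℝ) : ‖edgeTangent a‖ = 1 := by
  simp [edgeTangent, EuclideanSpace.norm_eq, Fin.sum_univ_two]

theorem inner_edgeNormal (a : ℝ) (x : Plane) :
    inner ℝ (edgeNormal a) x = Real.cos a * x 1 - Real.sin a * x 0 := by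
  simp [edgeNormal, PiLp.inner_apply, Fin.sum_univ_two]
  ring

theorem inner_edgeNormal_edgeTangent (a : ℝ) : inner ℝ (edgeNormal a) (edgeTangent a) = 0 := by
  rw [inner_edgeNormal]
  simp [edgeTangent]
  ring

/-- The disk is centred at the vertex, not at the origin, so that the edge is available for every ε,
however large. -/
theorem inclusionRight_inter_ball_vertex (hD : IsInclusionShape α μ D) {x : Plane}
    (hx : x ∈ ball (vertexRight ε) μ) :
    x ∈ inclusionRight D ε ↔ |x 1| < Real.tan (α / 2) * (x 0 - ε / 2) := by
  have h1 : x - vertexRight ε ∈ ball (0 : Plane) μ := by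
    rwa [mem_ball_zero_iff, ← dist_eq_norm]
  have := Set.ext_iff.mp hD.cone (x - vertexRight ε)
  simp only [mem_inter_iff, h1, and_true, mem_ofPred_eq] at this
  simpa [inclusionRight, vertexRight] using this

theorem sin_cos_pos (hα : 0 < α) (hα' : α < Real.pi) :
    0 < Real.sin (α / 2) ∧ 0 < Real.cos (α / 2) :=
  ⟨Real.sin_pos_of_pos_of_lt_pi (by linarith) (by linarith),
    Real.cos_pos_of_mem_Ioo ⟨by linarith, by linarith⟩⟩

theorem inner_edgeNormal_neg_of_cone (hα : 0 < α) (hα' : α < Real.pi) {x : Plane}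
    (hx : |x 1| < Real.tan (α / 2) * (x 0 - ε / 2)) :
    inner ℝ (edgeNormal (α / 2)) (x - vertexRight ε) < 0 := by
  obtain ⟨hs, hc⟩ := sin_cos_pos hα hα'
  have h1 := (le_abs_self _).trans_lt hx
  rw [Real.tan_eq_sin_div_cos, div_mul_eq_mul_div, lt_div_iff₀ hc] at h1
  rw [inner_edgeNormal]
  simp [vertexRight]
  linarith

theorem edge_mem_frontier (hα : 0 < α) (hα' : α < Real.pi) (hD : IsInclusionShape α μ D) {s : ℝ}
    (hs0 : 0 < s) (hs : s < μ) :
    vertexRight ε + s • edgeTangent (α / 2) ∈ frontier (inclusionRight D ε) := by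
  obtain ⟨hsin, hc⟩ := sin_cos_pos hα hα'
  set x := vertexRight ε + s • edgeTangent (α / 2)
  have hxb : x ∈ ball (vertexRight ε) μ := by
    simp [x, norm_smul, norm_edgeTangent, abs_of_pos hs0, hs]
  have ht : 0 < Real.tan (α / 2) := by rw [Real.tan_eq_sin_div_cos]; positivity
  have ht2 : Real.tan (α / 2) * Real.cos (α / 2) = Real.sin (α / 2) :=
    Real.tan_mul_cos hc.ne'
  have hx0 : x 0 = ε / 2 + s * Real.cos (α / 2) := by simp [x, vertexRight, edgeTangent]
  have hx1 : x 1 = s * Real.sin (α / 2) := by simp [x, vertexRight, edgeTangent]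
  rw [(isOpen_inclusionRight hD).frontier_eq]
  constructor
  · have hev : ∀ᶠ t in 𝓝[>] (0 : ℝ), x + t • e₀ ∈ inclusionRight D ε := by
      filter_upwards [(tendsto_add_smul x e₀).eventually (isOpen_ball.mem_nhds hxb),
        self_mem_nhdsWithin] with t ht1 ht0
      rw [inclusionRight_inter_ball_vertex hD ht1]
      have ht0' : 0 < t := ht0
      have e0 : (x + t • e₀) 0 = x 0 + t := by simp
      have e1 : (x + t • e₀) 1 = x 1 := by simp
      rw [e0, e1, hx0, hx1, abs_of_pos (by positivity)]
      have := mul_pos ht ht0'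
      nlinarith
    exact mem_closure_of_tendsto (tendsto_add_smul x e₀) hev
  · rw [inclusionRight_inter_ball_vertex hD hxb, hx0, hx1, not_lt]
    refine le_trans (le_of_eq ?_) (le_abs_self _)
    rw [← ht2]; ring

end Geometry

end BowTie

/-! ### Uniqueness: source-free potentials with zero fluxes vanish -/

namespace BowTie

open Topology InnerProductSpace Laplacian Metric

/-- A potential without sources in the exterior of the inclusions that decays at infinity. -/
structure IsSourceFreePotential (D : Set Plane) (ε c₁ c₂ : ℝ) (w : Plane → ℝ) : Prop where
  continuousOn : ContinuousOn w (exteriorSet D ε)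
  harmonic : HarmonicOnNhd w (exteriorDomain D ε)
  left : ∀ x ∈ frontier (inclusionLeft D ε), w x = c₁
  right : ∀ x ∈ frontier (inclusionRight D ε), w x = c₂
  flux_left : HasZeroFlux (inclusionLeft D ε) (vertexLeft ε) w
  flux_right : HasZeroFlux (inclusionRight D ε) (vertexRight ε) w
  decay : Tendsto w (Bornology.cobounded Plane) (𝓝 0)

variable {α μ ε c₁ c₂ : ℝ} {D : Set Plane} {w : Plane → ℝ}

theorem IsSourceFreePotential.neg (h : IsSourceFreePotential D ε c₁ c₂ w) :
    IsSourceFreePotential D ε (-c₁) (-c₂) (fun x => -w x) where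
  continuousOn := h.continuousOn.neg
  harmonic := h.harmonic.neg
  left x hx := by rw [h.left x hx]
  right x hx := by rw [h.right x hx]
  flux_left := h.flux_left.neg
  flux_right := h.flux_right.neg
  decay := by simpa using h.decay.neg

theorem tendsto_reflect_cobounded (i : Fin 2) :
    Tendsto (reflect i) (Bornology.cobounded Plane) (Bornology.cobounded Plane) := by
  rw [← tendsto_norm_atTop_iff_cobounded]
  simpa using tendsto_norm_cobounded_atTop (E := Plane)

theorem IsSourceFreePotential.reflect (hD : IsInclusionShape α μ D)
    (h : IsSourceFreePotential D ε c₁ c₂ w) :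
    IsSourceFreePotential D ε c₂ c₁ (fun x => w (reflect 0 x)) where
  continuousOn := h.continuousOn.comp (BowTie.reflect 0).continuous.continuousOn
    fun _ hx => reflect_mem_exteriorSet hD 0 hx
  harmonic x hx := HarmonicAt.comp_linearIsometryEquiv (BowTie.reflect 0)
    (h.harmonic _ (reflect_mem_exteriorDomain hD 0 hx))
  left x hx := by
    rw [frontier_inclusionLeft] at hx
    exact h.right _ hx
  right x hx := by
    refine h.left _ ?_
    rw [frontier_inclusionLeft, mem_preimage, reflect_reflect]
    exact hx
  flux_left := by
    have := h.flux_right.comp (BowTie.reflect 0)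
    rw [← inclusionLeft_eq, reflect_symm_apply] at this
    convert this using 1
    exact plane_ext (by simp [vertexLeft, vertexRight]) (by simp [vertexLeft, vertexRight])
  flux_right := by
    have := h.flux_left.comp (BowTie.reflect 0)
    rw [reflect_zero_preimage_left, reflect_symm_apply] at this
    convert this using 1
    exact plane_ext (by simp [vertexLeft, vertexRight]) (by simp [vertexLeft, vertexRight])
  decay := h.decay.comp (tendsto_reflect_cobounded 0)

/-- Maximum principle; the bound has to be nonnegative because of the value 0 at infinity. -/
theorem IsSourceFreePotential.le (hD : IsInclusionShape α μ D)
    (h : IsSourceFreePotential D ε c₁ c₂ w) {M : ℝ} (h0 : 0 ≤ M) (h1 : c₁ ≤ M) (h2 : c₂ ≤ M) :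
    ∀ x ∈ exteriorSet D ε, w x ≤ M := by
  have hfr : ∀ x, x ∈ frontier (inclusionLeft D ε) ∨ x ∈ frontier (inclusionRight D ε) →
      w x ≤ M := by
    rintro x (hx | hx)
    · rw [h.left x hx]; exact h1
    · rw [h.right x hx]; exact h2
  have hmax := le_zero_of_harmonicOnNhd (f := w - fun _ => M) isOpen_exteriorDomain
    (h.harmonic.sub (harmonicOnNhd_const M))
    (fun x hx δ hδ => by
      have hx' := frontier_exteriorDomain_subset hD hx
      have hxs := closure_exteriorDomain_subset hD (frontier_subset_closure hx)
      have hc : ContinuousWithinAt w (exteriorDomain D ε) x :=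
        (h.continuousOn x hxs).mono exteriorDomain_subset
      have hlt : w x < M + δ := by linarith [hfr x hx']
      filter_upwards [hc.eventually_lt_const hlt] with y hy
      simp only [Pi.sub_apply]
      linarith)
    (fun δ hδ => by
      filter_upwards [h.decay.eventually_lt_const hδ] with y hy _
      simp only [Pi.sub_apply]
      linarith)
  intro x hx
  rcases mem_exteriorSet_iff_cases hD hx with hx | hx
  · have := hmax x hx
    simp only [Pi.sub_apply] at this
    linarith
  · exact hfr x hx

theorem tendsto_smul_e₁ : Tendsto (fun t : ℝ => t • e₁) atTop (Bornology.cobounded Plane) := by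
  rw [← tendsto_norm_atTop_iff_cobounded]
  simpa [norm_smul] using tendsto_abs_atTop_atTop (G := ℝ)

/-- The part of the half-plane above the upper edge of the right cone near its vertex. -/
def edgeRegion (a ε r : ℝ) : Set Plane :=
  {x | 0 < inner ℝ (edgeNormal a) (x - vertexRight ε)} ∩ ball (vertexRight ε) r

/-- The right cone lies strictly below the line through its upper edge, and r ≤ ε/2 keeps the disk
in the right half-plane, away from the left inclusion. -/
theorem inter_ball_subset_exteriorSet (hα : 0 < α) (hα' : α < Real.pi)
    (hD : IsInclusionShape α μ D) {r : ℝ} (hrμ : r ≤ μ) (hrε : r ≤ ε / 2) :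
    {x | 0 ≤ inner ℝ (edgeNormal (α / 2)) (x - vertexRight ε)} ∩ ball (vertexRight ε) r ⊆
      exteriorSet D ε := by
  rintro x ⟨hx, hxb⟩ (h | h)
  · have h1 := lt_of_mem_inclusionLeft hD h
    have h2 := abs_apply_le_norm (x - vertexRight ε) 0
    rw [mem_ball, dist_eq_norm] at hxb
    have h3 : (x - vertexRight ε) 0 = x 0 - ε / 2 := by simp [vertexRight]
    rw [h3] at h2
    have := (abs_le.mp h2).1
    have := norm_nonneg (x - vertexRight ε)
    linarith
  · rw [inclusionRight_inter_ball_vertex hD (ball_subset_ball hrμ hxb)] at h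
    exact absurd (inner_edgeNormal_neg_of_cone hα hα' h) (not_lt.mpr hx)

theorem isOpen_edgeRegion (a ε r : ℝ) : IsOpen (edgeRegion a ε r) :=
  (isOpen_lt continuous_const (by fun_prop)).inter isOpen_ball

theorem edgeRegion_subset_exteriorDomain (hα : 0 < α) (hα' : α < Real.pi)
    (hD : IsInclusionShape α μ D) {r : ℝ} (hrμ : r ≤ μ) (hrε : r ≤ ε / 2) :
    edgeRegion (α / 2) ε r ⊆ exteriorDomain D ε :=
  mem_exteriorDomain_of_isOpen (isOpen_edgeRegion _ _ _) fun _ hx =>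
    inter_ball_subset_exteriorSet hα hα' hD hrμ hrε ⟨(show (0 : ℝ) < _ from hx.1).le, hx.2⟩

/-- Two convex sets with a common point. Their union links the edge to infinity through the gap, so
the strong maximum principle applies without connectedness of the whole exterior. -/
theorem isPreconnected_strip_union_edgeRegion (hα : 0 < α) (hα' : α < Real.pi) {r : ℝ}
    (hr : 0 < r) (hrε : r ≤ ε / 2) :
    IsPreconnected ({x : Plane | |x 0| < ε / 2} ∪ edgeRegion (α / 2) ε r) := by
  have hs := (sin_cos_pos hα hα').1
  have hconv : Convex ℝ (edgeRegion (α / 2) ε r) := by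
    refine Convex.inter ?_ (convex_ball _ _)
    have : {x : Plane | 0 < inner ℝ (edgeNormal (α / 2)) (x - vertexRight ε)} =
        {x | inner ℝ (edgeNormal (α / 2)) (vertexRight ε) < innerSL ℝ (edgeNormal (α / 2)) x} := by
      ext x; simp [inner_sub_right]
    rw [this]
    exact convex_halfSpace_gt (innerSL ℝ (edgeNormal (α / 2))).isLinear _
  have hstrip : Convex ℝ {x : Plane | |x 0| < ε / 2} := by
    have : {x : Plane | |x 0| < ε / 2} =
        (EuclideanSpace.proj 0 : Plane →L[ℝ] ℝ) ⁻¹' Ioo (-(ε / 2)) (ε / 2) := by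
      ext x; simp [abs_lt]
    rw [this]
    exact (convex_Ioo _ _).linear_preimage (EuclideanSpace.proj 0 : Plane →L[ℝ] ℝ).toLinearMap
  refine IsPreconnected.union (vertexRight ε - (r / 2) • e₀) ?_ ?_ hstrip.isPreconnected
    hconv.isPreconnected
  · have : (vertexRight ε - (r / 2) • e₀) 0 = ε / 2 - r / 2 := by simp [vertexRight]
    rw [mem_ofPred_eq, this, abs_lt]
    constructor <;> linarith
  · constructor
    · rw [mem_ofPred_eq, inner_edgeNormal]
      simp [vertexRight]
      positivity
    · simp [mem_ball, norm_smul, abs_of_pos hr]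
      exact hr

/-- If c₂ > 0, then c₂ is the maximum of w. On disks tangent to the upper edge of Ω₂, Harnack's
inequality for c₂ − w gives a linear drop of w away from the edge, which is Hopf's lemma. The flux
through ∂Ω₂ then cannot vanish. -/
theorem IsSourceFreePotential.right_le_zero (hα : 0 < α) (hα' : α < Real.pi) (hμ : 0 < μ)
    (hε : 0 < ε) (hD : IsInclusionShape α μ D) (h : IsSourceFreePotential D ε c₁ c₂ w)
    (h12 : c₁ ≤ c₂) : c₂ ≤ 0 := by
  by_contra! hpos
  have hle := h.le hD hpos.le h12 le_rfl
  set r := min μ (ε / 2) with hr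
  have hr0 : 0 < r := lt_min hμ (by positivity)
  have hrμ : r ≤ μ := min_le_left _ _
  have hrε : r ≤ ε / 2 := min_le_right _ _
  set a := α / 2
  set S := {x : Plane | |x 0| < ε / 2} ∪ edgeRegion a ε r with hS
  have hSo : IsOpen S := (isOpen_lt (by fun_prop) continuous_const).union (isOpen_edgeRegion _ _ _)
  have hSW : S ⊆ exteriorDomain D ε := union_subset (strip_subset_exteriorDomain hD)
    (edgeRegion_subset_exteriorDomain hα hα' hD hrμ hrε)
  set v : Plane → ℝ := (fun _ => c₂) - w with hv
  have hvh : HarmonicOnNhd v (exteriorDomain D ε) := (harmonicOnNhd_const c₂).sub h.harmonic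
  have hvnn : ∀ x ∈ exteriorSet D ε, 0 ≤ v x := fun x hx => by
    simp only [hv, Pi.sub_apply]; linarith [hle x hx]
  have hvpos : ∀ x ∈ S, 0 < v x := by
    intro x hx
    -- A zero of v would force w = c₂ > 0 along the strip, against the decay of w.
    refine lt_of_le_of_ne (hvnn x (exteriorDomain_subset (hSW hx))) fun h0 => ?_
    have hall := eqOn_zero_of_nonneg hSo (isPreconnected_strip_union_edgeRegion hα hα' hr0 hrε)
      (hvh.mono hSW) (fun y hy => hvnn y (exteriorDomain_subset (hSW hy))) hx h0.symm
    have hev := (h.decay.comp tendsto_smul_e₁).eventually_lt_const hpos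
    obtain ⟨t, ht⟩ := hev.exists
    have hmem : t • e₁ ∈ S := Or.inl (by simpa using hε)
    have := hall _ hmem
    simp only [hv, Pi.sub_apply] at this
    simp only [Function.comp] at ht
    linarith
  refine not_hasZeroFlux (P := vertexRight ε + (r / 8) • edgeTangent a)
    (Q := vertexRight ε + (r / 4) • edgeTangent a) h.right (fun x hx => ?_) (fun heq => ?_)
    (fun x hx => ?_) h.flux_right
  · have hx0 := (frontier_inclusionRight_subset hD hε hx).1
    have hc : ContinuousAt (fun y : Plane => y 0) x := by fun_prop
    filter_upwards [hc.eventually_const_lt (show (0 : ℝ) < x 0 by linarith)] with y hy hyΩ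
    refine hle y ?_
    rintro (hy' | hy')
    · have := lt_of_mem_inclusionLeft hD hy'
      linarith
    · exact hyΩ hy'
  · have h1 := add_left_cancel heq
    have h2 := congrArg norm h1
    rw [norm_smul, norm_smul, norm_edgeTangent, Real.norm_of_nonneg (by positivity),
      Real.norm_of_nonneg (by positivity)] at h2
    linarith
  · obtain ⟨s, hs1, hs2, rfl⟩ : ∃ s : ℝ, r / 8 ≤ s ∧ s ≤ r / 4 ∧
        x = vertexRight ε + s • edgeTangent a := by
      rw [segment_eq_image'] at hx
      obtain ⟨θ, ⟨hθ0, hθ1⟩, rfl⟩ := hx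
      refine ⟨r / 8 + θ * (r / 8), by nlinarith, by nlinarith, ?_⟩
      module
    have hs0 : 0 < s := by linarith
    set x := vertexRight ε + s • edgeTangent a with hxdef
    set ν := edgeNormal a with hν
    have hνn : ‖ν‖ = 1 := norm_edgeNormal a
    have hνν : inner ℝ ν ν = (1 : ℝ) := by rw [real_inner_self_eq_norm_sq, hνn]; norm_num
    have hxν : inner ℝ ν (x - vertexRight ε) = (0 : ℝ) := by
      rw [hxdef, add_sub_cancel_left, inner_smul_right, hν, inner_edgeNormal_edgeTangent, mul_zero]
    have hxV : dist x (vertexRight ε) = s := by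
      simp [hxdef, norm_smul, norm_edgeTangent, abs_of_pos hs0]
    refine ⟨edge_mem_frontier hα hα' hD hs0 (by linarith), fun heq => ?_, -ν, ?_, fun z hz => ?_, ?_⟩
    · rw [heq, dist_self] at hxV
      linarith
    · rw [norm_neg, hνn]
    · have hxb : x ∈ ball (vertexRight ε) μ := by rw [mem_ball, hxV]; linarith
      filter_upwards [(tendsto_add_smul x z).eventually (isOpen_ball.mem_nhds hxb),
        self_mem_nhdsWithin] with t ht ht0 hmem
      have ht0' : 0 < t := ht0
      rw [inclusionRight_inter_ball_vertex hD ht] at hmem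
      have h1 := inner_edgeNormal_neg_of_cone hα hα' hmem
      have h2 : x + t • z - vertexRight ε = (x - vertexRight ε) + t • z := by abel
      rw [h2, inner_add_right, ← hν, hxν, inner_smul_right, zero_add] at h1
      rw [inner_neg_left] at hz
      nlinarith
    -- The disk of radius ρ about q touches the edge line at x from outside the cone. It stays
    -- within s + 2ρ ≤ r/2 of the vertex.
    · set ρ := r / 8 with hρ
      have hρ0 : 0 < ρ := by positivity
      set q := x + ρ • ν with hq
      have hsplit : ∀ y : Plane, inner ℝ ν (y - vertexRight ε) = inner ℝ ν (y - q) + ρ := by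
        intro y
        have : y - vertexRight ε = (y - q) + ((x - vertexRight ε) + ρ • ν) := by rw [hq]; abel
        rw [this, inner_add_right, inner_add_right, hxν, inner_smul_right, hνν]
        ring
      have hinn : ∀ y : Plane, ρ - dist y q ≤ inner ℝ ν (y - vertexRight ε) := by
        intro y
        have h1 := (abs_le.mp (abs_real_inner_le_norm ν (y - q))).1
        rw [hνn, one_mul, ← dist_eq_norm] at h1
        rw [hsplit]
        linarith
      have hqx : dist q x = ρ := by
        simp [hq, norm_smul, hνn, abs_of_pos hρ0]
      have hball : closedBall q ρ ⊆ ball (vertexRight ε) r := by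
        intro y hy
        rw [mem_closedBall] at hy
        rw [mem_ball]
        have h1 := dist_triangle4 y q x (vertexRight ε)
        linarith
      have hsubS : ball q ρ ⊆ S := fun y hy => Or.inr ⟨by
        rw [mem_ball] at hy
        have := hinn y
        rw [mem_ofPred_eq]
        linarith, hball (ball_subset_closedBall hy)⟩
      have hsubF : closedBall q ρ ⊆ exteriorSet D ε := fun y hy =>
        inter_ball_subset_exteriorSet hα hα' hD hrμ hrε ⟨by
          rw [mem_closedBall] at hy
          have := hinn y
          rw [mem_ofPred_eq]
          linarith, hball hy⟩
      have hvq : 0 < v q := hvpos q (hsubS (mem_ball_self hρ0))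
      have hvc : ContinuousOn v (closedBall q ρ) :=
        continuousOn_const.sub (h.continuousOn.mono hsubF)
      refine ⟨v q / (2 * ρ), by positivity, ?_⟩
      filter_upwards [Ioo_mem_nhdsGT hρ0] with t ht
      have hdist : dist (x + t • ν) q = ρ - t := by
        have : x + t • ν - q = (t - ρ) • ν := by rw [hq]; module
        rw [dist_eq_norm, this, norm_smul, hνn, Real.norm_eq_abs, abs_of_neg (by linarith [ht.2])]
        ring
      have hharn := harnack_lower (v := v) (q := q) (y := x + t • ν) (R := ρ)
        (hvh.mono (hsubS.trans hSW)) hvc (fun y hy => hvnn y (hsubF hy))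
        (by rw [mem_ball, hdist]; linarith [ht.1])
      rw [hdist] at hharn
      have hk : t / (2 * ρ) ≤ (ρ - (ρ - t)) / (ρ + (ρ - t)) := by
        rw [div_le_div_iff₀ (by positivity) (by linarith [ht.2])]
        nlinarith [ht.1, ht.2]
      have h3 : t / (2 * ρ) * v q ≤ v (x + t • ν) :=
        (mul_le_mul_of_nonneg_right hk hvq.le).trans hharn
      rw [smul_neg, sub_neg_eq_add]
      simp only [hv, Pi.sub_apply] at h3 ⊢
      have h4 : t / (2 * ρ) * (c₂ - w q) = (c₂ - w q) / (2 * ρ) * t := by ring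
      linarith

/-- Reflection in the x₂-axis exchanges the two constants, so the larger one may be assumed to sit
on the right. -/
theorem IsSourceFreePotential.le_zero (hα : 0 < α) (hα' : α < Real.pi) (hμ : 0 < μ)
    (hε : 0 < ε) (hD : IsInclusionShape α μ D) (h : IsSourceFreePotential D ε c₁ c₂ w) :
    ∀ x ∈ exteriorSet D ε, w x ≤ 0 := by
  rcases le_total c₁ c₂ with h12 | h12
  · have := h.right_le_zero hα hα' hμ hε hD h12
    exact h.le hD le_rfl (h12.trans this) this
  · have := (h.reflect hD).right_le_zero hα hα' hμ hε hD h12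
    exact h.le hD le_rfl this (h12.trans this)

/-- A source free potential with zero fluxes vanishes. -/
theorem IsSourceFreePotential.eq_zero (hα : 0 < α) (hα' : α < Real.pi) (hμ : 0 < μ)
    (hε : 0 < ε) (hD : IsInclusionShape α μ D) (h : IsSourceFreePotential D ε c₁ c₂ w) :
    ∀ x ∈ exteriorSet D ε, w x = 0 := fun x hx =>
  le_antisymm (h.le_zero hα hα' hμ hε hD x hx) (by
    have := h.neg.le_zero hα hα' hμ hε hD x hx
    linarith)

end BowTie

/-! ### Regular part of the potential and its oddness -/

namespace BowTie

open Topology InnerProductSpace Laplacian Metric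

variable {α μ ε c₁ c₂ : ℝ} {D : Set Plane} {u : Plane → ℝ}

theorem continuousAt_dipole {x : Plane} (hx : x ≠ 0) : ContinuousAt dipole x :=
  (harmonicAt_dipole_potential hx).1.continuousAt

theorem support_laplacian_subset (φ : Plane → ℝ) : Function.support (Δ φ) ⊆ tsupport φ := by
  intro x hx
  by_contra hne
  rw [notMem_tsupport_iff_eventuallyEq] at hne
  have := (laplacian_congr_nhds hne).self_of_nhds
  refine hx ?_
  rw [this, laplacian_eq]
  have h0 : fderiv ℝ (0 : Plane → ℝ) = 0 := fderiv_zero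
  have h1 : fderiv ℝ (0 : Plane → Plane →L[ℝ] ℝ) = 0 := fderiv_zero
  simp [h0, h1]

theorem integrable_mul_laplacian {f φ : Plane → ℝ} {K : Set Plane} (hK : IsCompact K)
    (hf : IntegrableOn f K) (hφ : ContDiff ℝ (⊤ : ℕ∞) φ) (hsupp : tsupport φ ⊆ K) :
    Integrable (fun x => f x * Δ φ x) := by
  have hcont : Continuous (Δ φ) := by
    have h1 : ContDiff ℝ 1 (fderiv ℝ φ) := hφ.fderiv_right (by norm_cast)
    have h2 : Continuous (fderiv ℝ (fderiv ℝ φ)) := h1.continuous_fderiv one_ne_zero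
    have h3 : Δ φ = fun x => fderiv ℝ (fderiv ℝ φ) x e₀ e₀ + fderiv ℝ (fderiv ℝ φ) x e₁ e₁ :=
      funext fun x => laplacian_eq φ x
    rw [h3]
    fun_prop
  have hon : IntegrableOn (fun x => f x * Δ φ x) K :=
    hf.mul_continuousOn hcont.continuousOn hK
  refine (integrableOn_iff_integrable_of_support_subset fun x hx => hsupp ?_).mp hon
  exact support_laplacian_subset φ (right_ne_zero_of_mul hx)

theorem zero_mem_exteriorDomain (hD : IsInclusionShape α μ D) (hε : 0 < ε) :
    (0 : Plane) ∈ exteriorDomain D ε :=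
  strip_subset_exteriorDomain hD (by simpa using hε)

/-- The potentials of the theorem. -/
abbrev IsBowTiePotential (D : Set Plane) (ε : ℝ) (u : Plane → ℝ) : Prop :=
  IsEmitterPotential (inclusionLeft D ε) (inclusionRight D ε) (vertexLeft ε) (vertexRight ε)
    !₂[0, 1] 0 u

theorem continuousWithinAt_potential (hu : IsBowTiePotential D ε u) {x : Plane}
    (hx : x ∈ exteriorSet D ε) (hx0 : x ≠ 0) : ContinuousWithinAt u (exteriorSet D ε) x := by
  have hset : (inclusionLeft D ε ∪ inclusionRight D ε ∪ {0})ᶜ = exteriorSet D ε ∩ {0}ᶜ :=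
    compl_union _ _
  have := hu.continuousOn x (by rw [hset]; exact ⟨hx, hx0⟩)
  rw [hset] at this
  exact (continuousWithinAt_inter (isOpen_compl_singleton.mem_nhds hx0)).mp this

/-- The sources of u and the dipole cancel, so Weyl's lemma applies to the difference on a disk in
which the origin is either absent or the centre. -/
theorem exists_local_regular_part (hu : IsBowTiePotential D ε u)
    {p : Plane} (hp : p ∈ exteriorDomain D ε) :
    ∃ R > 0, ∃ H : Plane → ℝ, HarmonicOnNhd H (ball p R) ∧
      ∀ x ∈ ball p R, x ≠ p → H x = u x - dipole x := by
  obtain ⟨R, hR, hRsub, hR0⟩ : ∃ R > 0, closedBall p R ⊆ exteriorDomain D ε ∧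
      closedBall p R \ {p} ⊆ {0}ᶜ := by
    by_cases hp0 : p = 0
    · obtain ⟨R, hR, hsub⟩ := nhds_basis_closedBall.mem_iff.mp (isOpen_exteriorDomain.mem_nhds hp)
      exact ⟨R, hR, hsub, fun x hx => by rw [← hp0]; exact hx.2⟩
    · obtain ⟨R, hR, hsub⟩ := nhds_basis_closedBall.mem_iff.mp
        ((isOpen_exteriorDomain.inter isOpen_compl_singleton).mem_nhds ⟨hp, hp0⟩)
      exact ⟨R, hR, fun x hx => (hsub hx).1, fun x hx => (hsub hx.1).2⟩
  have hK : IsCompact (closedBall p R) := isCompact_closedBall p R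
  have hui : IntegrableOn u (closedBall p R) :=
    hu.equation.1.integrableOn_compact_subset hRsub hK
  have hdi : IntegrableOn dipole (closedBall p R) := locallyIntegrable_dipole.integrableOn_isCompact hK
  obtain ⟨H, hH, hHeq⟩ := exists_harmonic_of_weakly_harmonic (h := fun x => u x - dipole x) hR
    (hui.sub hdi)
    (fun x hx => by
      have hx0 : x ≠ 0 := hR0 hx
      have hxE := hRsub hx.1
      refine ContinuousWithinAt.sub ?_ (continuousAt_dipole hx0).continuousWithinAt
      exact (continuousWithinAt_potential hu (exteriorDomain_subset hxE) hx0).mono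
        (fun y hy => exteriorDomain_subset (hRsub hy.1)))
    (fun φ hφ hφc hφs => by
      have h1 := hu.equation.2 φ hφ hφc (hφs.trans hRsub)
      have h2 := integral_dipole_mul_laplacian hφ hφc
      have he : (!₂[0, 1] : Plane) = e₁ := plane_ext (by simp) (by simp)
      simp only [sub_mul]
      rw [integral_sub (integrable_mul_laplacian hK hui hφ hφs)
        (integrable_mul_laplacian hK hdi hφ hφs), h1, h2, he, sub_self])
  exact ⟨R / 4, by positivity, H, hH, hHeq⟩

/-- The potential is the sum of the dipole potential and a harmonic function. -/
theorem exists_regular_part (hD : IsInclusionShape α μ D) (hε : 0 < ε)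
    (hu : IsBowTiePotential D ε u) :
    ∃ H : Plane → ℝ, HarmonicOnNhd H (exteriorDomain D ε) ∧ ∀ x ≠ 0, H x = u x - dipole x := by
  obtain ⟨R₀, hR₀, H₀, hH₀, hH₀eq⟩ :=
    exists_local_regular_part hu (zero_mem_exteriorDomain hD hε)
  -- The value of u at the origin is arbitrary, so the value there is taken from the local harmonic
  -- extension.
  refine ⟨Function.update (fun x => u x - dipole x) 0 (H₀ 0), fun p hp => ?_, fun x hx => ?_⟩
  · by_cases hp0 : p = 0
    · subst hp0
      refine (harmonicAt_congr_nhds ?_).mp (hH₀ 0 (mem_ball_self hR₀))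
      filter_upwards [ball_mem_nhds (0 : Plane) hR₀] with x hx
      by_cases hx0 : x = 0
      · simp [hx0]
      · rw [Function.update_of_ne hx0, hH₀eq x hx hx0]
    · obtain ⟨R, hR, H, hH, hHeq⟩ := exists_local_regular_part hu hp
      refine (harmonicAt_congr_nhds ?_).mp (hH p (mem_ball_self hR))
      have hcont : ContinuousAt (fun x => u x - dipole x) p := by
        refine ContinuousAt.sub ?_ (continuousAt_dipole hp0)
        exact (continuousWithinAt_potential hu (exteriorDomain_subset hp) hp0).continuousAt
          (mem_of_superset (isOpen_exteriorDomain.mem_nhds hp) exteriorDomain_subset)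
      -- Weyl's lemma gives equality only off the centre; continuity of both sides supplies the
      -- centre.
      have hp_eq : H p = u p - dipole p := by
        have h1 : Tendsto H (𝓝[≠] p) (𝓝 (H p)) :=
          (hH p (mem_ball_self hR)).1.continuousAt.tendsto.mono_left nhdsWithin_le_nhds
        have h2 : Tendsto (fun x => u x - dipole x) (𝓝[≠] p) (𝓝 (u p - dipole p)) :=
          hcont.tendsto.mono_left nhdsWithin_le_nhds
        refine tendsto_nhds_unique h1 (h2.congr' ?_)
        filter_upwards [mem_nhdsWithin_of_mem_nhds (ball_mem_nhds p hR), self_mem_nhdsWithin]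
          with x hx hxp using (hHeq x hx hxp).symm
      filter_upwards [ball_mem_nhds p hR, isOpen_compl_singleton.mem_nhds hp0] with x hx hx0
      rw [Function.update_of_ne hx0]
      by_cases hxp : x = p
      · rw [hxp, hp_eq]
      · exact hHeq x hx hxp
  · rw [Function.update_of_ne hx]

theorem dipole_reflect_one (x : Plane) : dipole (reflect 1 x) = -dipole x := by
  simp only [dipole, LinearIsometryEquiv.norm_map, reflect_one_one]
  ring

theorem tendsto_inv_norm_cobounded :
    Tendsto (fun x : Plane => ‖x‖⁻¹) (Bornology.cobounded Plane) (𝓝 0) :=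
  tendsto_inv_atTop_zero.comp tendsto_norm_cobounded_atTop

theorem tendsto_dipole_cobounded : Tendsto dipole (Bornology.cobounded Plane) (𝓝 0) := by
  refine squeeze_zero_norm norm_dipole_le ?_
  simpa using tendsto_inv_norm_cobounded.const_mul (2 * Real.pi)⁻¹

theorem tendsto_potential_cobounded (hu : IsBowTiePotential D ε u) :
    Tendsto u (Bornology.cobounded Plane) (𝓝 0) :=
  hu.decay.trans_tendsto tendsto_inv_norm_cobounded

theorem ne_zero_of_mem_frontier (hD : IsInclusionShape α μ D) (hε : 0 < ε) {x : Plane}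
    (hx : x ∈ frontier (inclusionLeft D ε) ∨ x ∈ frontier (inclusionRight D ε)) : x ≠ 0 := by
  rintro rfl
  rcases hx with hx | hx
  · have := (frontier_inclusionLeft_subset hD hε hx).1
    simp at this
    linarith
  · have := (frontier_inclusionRight_subset hD hε hx).1
    simp at this
    linarith

/-- The regular part of the potential, together with its symmetry and boundary behaviour. -/
theorem exists_odd_regular_part (hα : 0 < α) (hα' : α < Real.pi) (hμ : 0 < μ) (hε : 0 < ε)
    (hD : IsInclusionShape α μ D) (hu : IsBowTiePotential D ε u) :
    ∃ H : Plane → ℝ, HarmonicOnNhd H (exteriorDomain D ε) ∧ ContinuousOn H (exteriorSet D ε) ∧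
      (∀ x ≠ 0, H x = u x - dipole x) ∧ (∀ x ∈ exteriorSet D ε, H (reflect 1 x) = -H x) ∧
      Tendsto H (Bornology.cobounded Plane) (𝓝 0) ∧
      ∀ x, x ∈ frontier (inclusionLeft D ε) ∨ x ∈ frontier (inclusionRight D ε) → u x = 0 := by
  obtain ⟨H, hH, hHeq⟩ := exists_regular_part hD hε hu
  have hHc : ContinuousOn H (exteriorSet D ε) := by
    intro x hx
    by_cases hx0 : x = 0
    · exact (hH x (hx0 ▸ zero_mem_exteriorDomain hD hε)).1.continuousAt.continuousWithinAt
    · have h1 := (continuousWithinAt_potential hu hx hx0).sub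
        (continuousAt_dipole hx0).continuousWithinAt
      refine h1.congr_of_eventuallyEq ?_ (hHeq x hx0)
      filter_upwards [mem_nhdsWithin_of_mem_nhds (isOpen_compl_singleton.mem_nhds hx0)] with y hy
      exact hHeq y hy
  have hHdecay : Tendsto H (Bornology.cobounded Plane) (𝓝 0) := by
    have h1 := (tendsto_potential_cobounded hu).sub tendsto_dipole_cobounded
    rw [sub_zero] at h1
    refine h1.congr' ?_
    filter_upwards [Bornology.isCobounded_compl_iff.mpr (Bornology.isBounded_singleton (x := (0 : Plane)))]
      with x hx
    exact (hHeq x hx).symm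
  have hsum : ∀ x ≠ 0, H x + H (reflect 1 x) = u x + u (reflect 1 x) := by
    intro x hx
    rw [hHeq x hx, hHeq _ ((map_ne_zero_iff _ (reflect 1).injective).mpr hx), dipole_reflect_one]
    ring
  obtain ⟨c₁, hc₁⟩ := hu.constant₁
  obtain ⟨c₂, hc₂⟩ := hu.constant₂
  have hrefl_left : ∀ x ∈ frontier (inclusionLeft D ε),
      reflect 1 x ∈ frontier (inclusionLeft D ε) := by
    intro x hx
    have := (reflect 1).toHomeomorph.preimage_frontier (inclusionLeft D ε)
    rw [show (reflect 1).toHomeomorph ⁻¹' inclusionLeft D ε = inclusionLeft D ε from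
      reflect_one_preimage_left hD ε] at this
    rw [← this] at hx
    exact hx
  have hrefl_right : ∀ x ∈ frontier (inclusionRight D ε),
      reflect 1 x ∈ frontier (inclusionRight D ε) := by
    intro x hx
    have := (reflect 1).toHomeomorph.preimage_frontier (inclusionRight D ε)
    rw [show (reflect 1).toHomeomorph ⁻¹' inclusionRight D ε = inclusionRight D ε from
      reflect_one_preimage_right hD ε] at this
    rw [← this] at hx
    exact hx
  have hsumev : ∀ x : Plane, x ≠ 0 →
      ∀ᶠ y in 𝓝 x, H y + H (reflect 1 y) = u y + u (reflect 1 y) := by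
    intro x hx
    filter_upwards [isOpen_compl_singleton.mem_nhds hx] with y hy using hsum y hy
  -- The dipole is odd under the reflection, so off the origin this symmetrised H equals the
  -- symmetrised u. It inherits the zero fluxes, with boundary values 2c₁ and 2c₂.
  have hfree : IsSourceFreePotential D ε (c₁ + c₁) (c₂ + c₂)
      (fun x => H x + H (reflect 1 x)) := by
    refine ⟨?_, fun x hx => ?_, fun x hx => ?_, fun x hx => ?_, ?_, ?_, ?_⟩
    · exact hHc.add (hHc.comp (reflect 1).continuous.continuousOn
        fun _ hx => reflect_mem_exteriorSet hD 1 hx)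
    · exact (hH x hx).add (HarmonicAt.comp_linearIsometryEquiv (reflect 1)
        (hH _ (reflect_mem_exteriorDomain hD 1 hx)))
    · rw [hsum x (ne_zero_of_mem_frontier hD hε (Or.inl hx)), hc₁ x hx, hc₁ _ (hrefl_left x hx)]
    · rw [hsum x (ne_zero_of_mem_frontier hD hε (Or.inr hx)), hc₂ x hx, hc₂ _ (hrefl_right x hx)]
    · have h1 := hu.flux₁.comp (reflect 1)
      rw [reflect_one_preimage_left hD, reflect_symm_apply,
        show reflect 1 (vertexLeft ε) = vertexLeft ε from
          plane_ext (by simp) (by simp [vertexLeft])] at h1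
      exact (hu.flux₁.add h1).congr fun x hx =>
        hsumev x (ne_zero_of_mem_frontier hD hε (Or.inl hx))
    · have h1 := hu.flux₂.comp (reflect 1)
      rw [reflect_one_preimage_right hD, reflect_symm_apply,
        show reflect 1 (vertexRight ε) = vertexRight ε from
          plane_ext (by simp) (by simp [vertexRight])] at h1
      exact (hu.flux₂.add h1).congr fun x hx =>
        hsumev x (ne_zero_of_mem_frontier hD hε (Or.inr hx))
    · simpa using hHdecay.add (hHdecay.comp (tendsto_reflect_cobounded 1))
  have hzero := hfree.eq_zero hα hα' hμ hε hD
  refine ⟨H, hH, hHc, hHeq, fun x hx => ?_, hHdecay, ?_⟩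
  · have := hzero x hx
    linarith
  · rintro x (hx | hx)
    · have h1 := hfree.left x hx
      rw [hzero x (frontier_inclusionLeft_subset hD hε hx).2] at h1
      rw [hc₁ x hx]
      linarith
    · have h1 := hfree.right x hx
      rw [hzero x (frontier_inclusionRight_subset hD hε hx).2] at h1
      rw [hc₂ x hx]
      linarith

end BowTie

/-! ### Half-plane barrier and the bound 0 ≤ u ≤ N -/

namespace BowTie

open Topology InnerProductSpace Laplacian Metric

/-- A barrier estimate: a harmonic function that is nonpositive on the boundary of a domain in a
half-plane grows at most linearly away from the boundary line of the half-plane. -/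
theorem le_of_mem_halfPlane {G : Set Plane} {u : Plane → ℝ} {n p : Plane} {R M t : ℝ}
    (hG : IsOpen G) (hn : ‖n‖ = 1) (hR : 0 < R) (hM : 0 < M)
    (hu : HarmonicOnNhd u (G ∩ ball p R)) (hc : ContinuousOn u (closure (G ∩ ball p R)))
    (hb : ∀ x ∈ closure (G ∩ ball p R), x ∉ G → u x ≤ 0) (huM : ∀ x ∈ G ∩ ball p R, u x ≤ M)
    (hhalf : ∀ x ∈ G ∩ ball p R, 0 ≤ inner ℝ n (x - p)) (ht : 0 < t) (htR : t < R)
    (htG : p + t • n ∈ G) : u (p + t • n) ≤ 2 * M * t / R := by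
  set U := G ∩ ball p R with hU
  -- The barrier b is 1 minus a dipole field with pole at distance R behind p. Its zero circle has
  -- the segment from q to p as a diameter, so b ≥ 0 on the half-plane. There b = 1/2 on |x − p| =
  -- R, and b = t/(t + R) at p + t • n.
  set q := p - R • n with hq
  set b : Plane → ℝ := fun x => 1 - R * (inner ℝ (x - q) n / ‖x - q‖ ^ 2) with hbdef
  have hUo : IsOpen U := hG.inter isOpen_ball
  have hnn : inner ℝ n n = (1 : ℝ) := by rw [real_inner_self_eq_norm_sq, hn]; norm_num
  have hcl : ∀ x ∈ closure U, 0 ≤ inner ℝ n (x - p) := by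
    have : closure U ⊆ {x | 0 ≤ inner ℝ n (x - p)} :=
      closure_minimal hhalf (isClosed_le continuous_const (by fun_prop))
    exact this
  have hinner : ∀ x, inner ℝ (x - q) n = inner ℝ n (x - p) + R := by
    intro x
    have : x - q = (x - p) + R • n := by rw [hq]; abel
    rw [this, inner_add_left, inner_smul_left, hnn, real_inner_comm]
    simp
  have hnorm : ∀ x, ‖x - q‖ ^ 2 = ‖x - p‖ ^ 2 + 2 * R * inner ℝ n (x - p) + R ^ 2 := by
    intro x
    have : x - q = (x - p) + R • n := by rw [hq]; abel
    rw [this, norm_add_sq_real, inner_smul_right, norm_smul, hn, real_inner_comm,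
      Real.norm_of_nonneg hR.le]
    ring
  have hpos : ∀ x, 0 ≤ inner ℝ n (x - p) → 0 < ‖x - q‖ ^ 2 := by
    intro x hx
    rw [hnorm]
    positivity
  have hb0 : ∀ x, 0 ≤ inner ℝ n (x - p) → 0 ≤ b x := by
    intro x hx
    have h1 := abs_le.mp (abs_real_inner_le_norm n (x - p))
    rw [hn, one_mul] at h1
    simp only [hbdef]
    rw [← mul_div_assoc, sub_nonneg, div_le_one (hpos x hx), hnorm, hinner]
    nlinarith [norm_nonneg (x - p), mul_nonneg hR.le hx]
  have hb1 : ∀ x, 0 ≤ inner ℝ n (x - p) → ‖x - p‖ = R → 1 / 2 ≤ b x := by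
    intro x hx hxR
    simp only [hbdef]
    have : R * (inner ℝ (x - q) n / ‖x - q‖ ^ 2) ≤ 1 / 2 := by
      rw [← mul_div_assoc, div_le_iff₀ (hpos x hx), hnorm, hinner, hxR]
      nlinarith
    linarith
  have hbh : ∀ x, 0 ≤ inner ℝ n (x - p) → HarmonicAt b x := by
    intro x hx
    have hne : x + -q ≠ 0 := by
      intro h0
      have := hpos x hx
      rw [sub_eq_add_neg, h0] at this
      simp at this
    have h1 := HarmonicAt.comp_add_right (-q) (harmonicAt_dipole n hne)
    have h2 := (harmonicAt_const (1 : ℝ) (x := x)).sub (h1.const_smul (c := R))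
    have heq : b = (fun _ => (1 : ℝ)) -
        R • fun y => inner ℝ (y + -q) n / ‖y + -q‖ ^ 2 := by
      ext y
      simp [hbdef, sub_eq_add_neg]
    rw [heq]
    exact h2
  have hmax := le_zero_of_harmonicOnNhd_of_isBounded (f := u - (2 * M) • b) hUo
    (isBounded_ball.subset inter_subset_right)
    (hu.sub (fun x hx => (hbh x (hhalf x hx)).const_smul))
    (hc.sub (fun x hx => ((hbh x (hcl x hx)).1.continuousAt.continuousWithinAt).const_smul _))
    (fun x hx => by
      rw [hUo.frontier_eq] at hx
      have hx0 := hcl x hx.1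
      simp only [Pi.sub_apply, Pi.smul_apply, smul_eq_mul]
      by_cases hxG : x ∈ G
      · have hxp : ‖x - p‖ = R := by
          refine le_antisymm ?_ ?_
          · have : x ∈ closedBall p R :=
              closure_ball_subset_closedBall (closure_mono inter_subset_right hx.1)
            rwa [mem_closedBall, dist_eq_norm] at this
          · by_contra! hlt
            exact hx.2 ⟨hxG, by rwa [mem_ball, dist_eq_norm]⟩
        have h1 : u x ≤ M := by
          have h2 : ContinuousWithinAt u U x := (hc x hx.1).mono subset_closure
          have : (𝓝[U] x).NeBot := mem_closure_iff_nhdsWithin_neBot.mp hx.1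
          exact le_of_tendsto h2 (by filter_upwards [self_mem_nhdsWithin] with y hy using huM y hy)
        nlinarith [hb1 x hx0 hxp]
      · nlinarith [hb x hx.1 hxG, hb0 x hx0])
  have hmem : p + t • n ∈ U := ⟨htG, by
    simp [mem_ball, norm_smul, hn, abs_of_pos ht, htR]⟩
  have h1 := hmax _ hmem
  simp only [Pi.sub_apply, Pi.smul_apply, smul_eq_mul] at h1
  have hbt : b (p + t • n) ≤ t / R := by
    have e1 : inner ℝ n (p + t • n - p) = t := by
      rw [add_sub_cancel_left, inner_smul_right, hnn, mul_one]
    have e2 : ‖p + t • n - p‖ = t := by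
      rw [add_sub_cancel_left, norm_smul, hn, mul_one, Real.norm_of_nonneg ht.le]
    simp only [hbdef]
    rw [hnorm, hinner, e1, e2]
    have e3 : R * ((t + R) / (t ^ 2 + 2 * R * t + R ^ 2)) = R / (t + R) := by
      have : t ^ 2 + 2 * R * t + R ^ 2 = (t + R) * (t + R) := by ring
      rw [this]
      field_simp
    rw [e3, one_sub_div (by positivity), add_sub_cancel_right]
    exact div_le_div_of_nonneg_left ht.le hR (by linarith)
  calc u (p + t • n) ≤ 2 * M * b (p + t • n) := by linarith
    _ ≤ 2 * M * (t / R) := by gcongr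
    _ = _ := by ring

/-- The part of the exterior of the inclusions that lies above the first axis. -/
def upperDomain (D : Set Plane) (ε : ℝ) : Set Plane := exteriorDomain D ε ∩ {x | 0 < x 1}

variable {α μ ε : ℝ} {D : Set Plane} {u : Plane → ℝ}

theorem isOpen_upperDomain : IsOpen (upperDomain D ε) :=
  isOpen_exteriorDomain.inter (isOpen_lt continuous_const (by fun_prop))

/-- The properties of the potential on which the gradient estimate rests. -/
structure IsDominatedPotential (D : Set Plane) (ε : ℝ) (u : Plane → ℝ) : Prop where
  harmonic : ∀ x ∈ exteriorDomain D ε, x ≠ 0 → HarmonicAt u x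
  continuous : ∀ x ∈ exteriorSet D ε, x ≠ 0 → ContinuousWithinAt u (exteriorSet D ε) x
  boundary : ∀ x ∈ closure (upperDomain D ε), x ∉ upperDomain D ε → x ≠ 0 → u x = 0
  nonneg : ∀ x ∈ upperDomain D ε, 0 ≤ u x
  le_dipole : ∀ x ∈ upperDomain D ε, u x ≤ dipole x
  odd : ∀ x ∈ exteriorSet D ε, x ≠ 0 → u (reflect 1 x) = -u x

theorem closure_upperDomain_subset (hD : IsInclusionShape α μ D) :
    closure (upperDomain D ε) ⊆ exteriorSet D ε ∩ {x | 0 ≤ x 1} :=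
  closure_minimal (fun _ hx => ⟨exteriorDomain_subset hx.1, (show (0 : ℝ) < _ from hx.2).le⟩)
    ((isClosed_exteriorSet hD).inter (isClosed_le continuous_const (by fun_prop)))

theorem dipole_nonneg {x : Plane} (hx : 0 ≤ x 1) : 0 ≤ dipole x := by
  unfold dipole; positivity

/-- Oddness makes u vanish on the axis off the origin and H vanish at the origin. On the rest of the
boundary u = 0, that is H = −N ≤ 0. The maximum principle for H and for −u then gives both bounds.
-/
theorem IsDominatedPotential.of_isBowTiePotential (hα : 0 < α) (hα' : α < Real.pi) (hμ : 0 < μ)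
    (hε : 0 < ε) (hD : IsInclusionShape α μ D) (hu : IsBowTiePotential D ε u) :
    IsDominatedPotential D ε u := by
  obtain ⟨H, hH, hHc, hHeq, hodd, hdecay, hfr⟩ := exists_odd_regular_part hα hα' hμ hε hD hu
  have hne : ∀ x : Plane, x ≠ 0 → reflect 1 x ≠ 0 := fun x hx =>
    (map_ne_zero_iff _ (reflect 1).injective).mpr hx
  have hu_eq : ∀ x ≠ 0, u x = H x + dipole x := fun x hx => by rw [hHeq x hx]; ring
  have hu_odd : ∀ x ∈ exteriorSet D ε, x ≠ 0 → u (reflect 1 x) = -u x := by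
    intro x hx hx0
    rw [hu_eq x hx0, hu_eq _ (hne x hx0), hodd x hx, dipole_reflect_one]
    ring
  have haxis : ∀ x ∈ exteriorSet D ε, x 1 = 0 → H x = 0 := by
    intro x hx hx1
    have hfix : reflect 1 x = x := plane_ext (by simp) (by simp [hx1])
    have := hodd x hx
    rw [hfix] at this
    linarith
  have hbdry : ∀ x ∈ closure (upperDomain D ε), x ∉ upperDomain D ε → x ≠ 0 → u x = 0 := by
    intro x hx hxU hx0
    have hx' := closure_upperDomain_subset hD hx
    rcases mem_exteriorSet_iff_cases hD hx'.1 with hxE | hxF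
    · have hx1 : x 1 = 0 := le_antisymm (not_lt.mp fun h => hxU ⟨hxE, h⟩) hx'.2
      rw [hu_eq x hx0, haxis x hx'.1 hx1]
      simp [dipole, hx1]
    · exact hfr x hxF
  have hHU : HarmonicOnNhd H (upperDomain D ε) := hH.mono inter_subset_left
  have hne0 : ∀ x ∈ upperDomain D ε, x ≠ 0 := by
    rintro x hx rfl
    simpa using hx.2
  have hHw : ∀ x ∈ frontier (upperDomain D ε), ContinuousWithinAt H (upperDomain D ε) x :=
    fun x hx => (hHc x (closure_upperDomain_subset hD (frontier_subset_closure hx)).1).mono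
      (fun y hy => exteriorDomain_subset hy.1)
  have hH0 : H 0 = 0 :=
    haxis 0 (exteriorDomain_subset (zero_mem_exteriorDomain hD hε)) (by simp)
  have hHle : ∀ x ∈ upperDomain D ε, H x ≤ 0 := by
    refine le_zero_of_harmonicOnNhd isOpen_upperDomain hHU (fun x hx δ hδ => ?_) (fun δ hδ => ?_)
    · have hxle : H x ≤ 0 := by
        by_cases hx0 : x = 0
        · rw [hx0, hH0]
        · have hx' := hx
          rw [isOpen_upperDomain.frontier_eq] at hx'
          rw [hHeq x hx0, hbdry x hx'.1 hx'.2 hx0]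
          linarith [dipole_nonneg (closure_upperDomain_subset hD hx'.1).2]
      filter_upwards [(hHw x hx).eventually_lt_const (hxle.trans_lt hδ)] with y hy using hy.le
    · filter_upwards [hdecay.eventually_lt_const hδ] with y hy _ using hy.le
  have hdh : HarmonicOnNhd dipole (upperDomain D ε) := fun x hx =>
    harmonicAt_dipole_potential (hne0 x hx)
  have hnonneg : ∀ x ∈ upperDomain D ε, (-(H + dipole)) x ≤ 0 := by
    refine le_zero_of_harmonicOnNhd isOpen_upperDomain (hHU.add hdh).neg
      (fun x hx δ hδ => ?_) (fun δ hδ => ?_)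
    -- At the origin N is unbounded but nonnegative from above the axis, and H tends to 0. Hence u
    -- is almost nonnegative there.
    · by_cases hx0 : x = 0
      · have hlt : -δ < H x := by rw [hx0, hH0]; linarith
        filter_upwards [(hHw x hx).eventually_const_lt hlt, self_mem_nhdsWithin] with y hy hyU
        have := dipole_nonneg (le_of_lt hyU.2)
        simp only [Pi.neg_apply, Pi.add_apply]
        linarith
      · have hx' := hx
        rw [isOpen_upperDomain.frontier_eq] at hx'
        have h1 : ContinuousWithinAt (-(H + dipole)) (upperDomain D ε) x :=
          ((hHw x hx).add (continuousAt_dipole hx0).continuousWithinAt).neg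
        have h2 : (-(H + dipole)) x < δ := by
          simp only [Pi.neg_apply, Pi.add_apply]
          rw [← hu_eq x hx0, hbdry x hx'.1 hx'.2 hx0]
          simpa using hδ
        filter_upwards [h1.eventually_lt_const h2] with y hy using hy.le
    · have h1 := hdecay.add tendsto_dipole_cobounded
      rw [add_zero] at h1
      filter_upwards [h1.eventually_const_lt (show -δ < 0 by linarith)] with y hy _
      simp only [Pi.neg_apply, Pi.add_apply]
      linarith
  refine ⟨fun x hx hx0 => ?_, fun x hx hx0 => continuousWithinAt_potential hu hx hx0, hbdry,
    fun x hx => ?_, fun x hx => ?_, hu_odd⟩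
  · refine (harmonicAt_congr_nhds ?_).mp ((hH x hx).add (harmonicAt_dipole_potential hx0))
    filter_upwards [isOpen_compl_singleton.mem_nhds hx0] with y hy using (hu_eq y hy).symm
  · have := hnonneg x hx
    simp only [Pi.neg_apply, Pi.add_apply] at this
    rw [hu_eq x (hne0 x hx)]
    linarith
  · rw [hu_eq x (hne0 x hx)]
    linarith [hHle x hx]

end BowTie

/-! ### Linear growth at the boundary and the gradient bound -/

namespace BowTie

open Topology InnerProductSpace Laplacian Metric

variable {α μ ε : ℝ} {D : Set Plane} {u : Plane → ℝ}

/-- The distance to the line through the upper edge of the right cone. -/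
noncomputable def edgeDistRight (α ε : ℝ) (x : Plane) : ℝ :=
  inner ℝ (edgeNormal (α / 2)) (x - vertexRight ε)

/-- The distance to the line through the upper edge of the left cone. -/
noncomputable def edgeDistLeft (α ε : ℝ) (x : Plane) : ℝ :=
  inner ℝ (reflect 0 (edgeNormal (α / 2))) (x - vertexLeft ε)

theorem edgeDistLeft_eq (α ε : ℝ) (x : Plane) :
    edgeDistLeft α ε x = edgeDistRight α ε (reflect 0 x) := by
  have h : x - vertexLeft ε = reflect 0 (reflect 0 x - vertexRight ε) :=
    plane_ext (by simp [vertexLeft, vertexRight, add_comm]) (by simp [vertexLeft, vertexRight])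
  rw [edgeDistLeft, h, LinearIsometryEquiv.inner_map_map, edgeDistRight]

theorem edgeDistRight_nonneg_iff (hα : 0 < α) (hα' : α < Real.pi) (x : Plane) :
    0 ≤ edgeDistRight α ε x ↔ Real.tan (α / 2) * (x 0 - ε / 2) ≤ x 1 := by
  obtain ⟨_, hc⟩ := sin_cos_pos hα hα'
  rw [edgeDistRight, inner_edgeNormal, Real.tan_eq_sin_div_cos, div_mul_eq_mul_div,
    div_le_iff₀ hc]
  simp only [vertexRight, PiLp.sub_apply]
  simp only [Matrix.cons_val_zero, Matrix.cons_val_one, Matrix.cons_val_fin_one, sub_zero]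
  constructor <;> intro h <;> linarith

theorem notMem_inclusionRight_iff (hα : 0 < α) (hα' : α < Real.pi) (hD : IsInclusionShape α μ D)
    (hε : 0 < ε) {x : Plane} (hx : x ∈ ball (0 : Plane) μ) (hx1 : 0 < x 1) :
    x ∉ inclusionRight D ε ↔ 0 ≤ edgeDistRight α ε x := by
  have h := Set.ext_iff.mp (inclusionRight_inter_ball hα hα' hD hε.le) x
  simp only [mem_inter_iff, hx, and_true, mem_ofPred_eq] at h
  rw [h, edgeDistRight_nonneg_iff hα hα', not_lt, abs_of_pos hx1]

theorem mem_exteriorSet_iff (hα : 0 < α) (hα' : α < Real.pi) (hD : IsInclusionShape α μ D)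
    (hε : 0 < ε) {x : Plane} (hx : x ∈ ball (0 : Plane) μ) (hx1 : 0 < x 1) :
    x ∈ exteriorSet D ε ↔ 0 ≤ edgeDistLeft α ε x ∧ 0 ≤ edgeDistRight α ε x := by
  have hx' : reflect 0 x ∈ ball (0 : Plane) μ := by
    rw [mem_ball_zero_iff] at hx ⊢
    rwa [LinearIsometryEquiv.norm_map]
  rw [edgeDistLeft_eq, ← notMem_inclusionRight_iff hα hα' hD hε hx hx1,
    ← notMem_inclusionRight_iff hα hα' hD hε hx' (by simpa using hx1), exteriorSet,
    inclusionLeft_eq, mem_compl_iff, mem_union, not_or, mem_preimage]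

/-- A small step against n stays in U and lowers the inner product, so equality with 0 is
impossible. -/
theorem inner_pos_of_isOpen {U : Set Plane} {n V : Plane} (hU : IsOpen U) (hn : ‖n‖ = 1)
    (h : ∀ x ∈ U, 0 ≤ inner ℝ n (x - V)) : ∀ x ∈ U, 0 < inner ℝ n (x - V) := by
  intro x hx
  have hev := ((tendsto_add_smul x (-n)).eventually (hU.mem_nhds hx)).and
    (self_mem_nhdsWithin (s := Ioi (0 : ℝ)))
  obtain ⟨t, ht, ht0⟩ := hev.exists
  have h1 := h _ ht
  have h2 : x + t • -n - V = (x - V) - t • n := by module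
  have h3 : 0 < t := ht0
  rw [h2, inner_sub_right, inner_smul_right, real_inner_self_eq_norm_sq, hn] at h1
  linarith

theorem dist_inner_le {n : Plane} (hn : ‖n‖ = 1) (V x y : Plane) :
    |inner ℝ n (y - V) - inner ℝ n (x - V)| ≤ dist y x := by
  have h := abs_real_inner_le_norm n (y - x)
  rw [hn, one_mul] at h
  rw [← inner_sub_right, sub_sub_sub_cancel_right, dist_eq_norm]
  exact h

theorem dipole_le {x : Plane} {r : ℝ} (hr : 0 < r) (hx : r ≤ ‖x‖) :
    dipole x ≤ (2 * Real.pi)⁻¹ * r⁻¹ :=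
  (le_abs_self _).trans ((norm_dipole_le x).trans (by gcongr))

theorem dipole_le_of_apply_le {x : Plane} {r s : ℝ} (hr : 0 < r) (hx : r ≤ ‖x‖) (hx1 : 0 ≤ x 1)
    (hs : x 1 ≤ s) : dipole x ≤ (2 * Real.pi)⁻¹ * (s / r ^ 2) := by
  have hs0 : 0 ≤ s := hx1.trans hs
  unfold dipole
  gcongr

/-- Linear growth of the potential away from one of the upper edges. -/
theorem IsDominatedPotential.growth (hD : IsInclusionShape α μ D)
    (hu : IsDominatedPotential D ε u) {n V X y : Plane} (hn : ‖n‖ = 1) {r ρ d M : ℝ}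
    (hM : 0 < M) (hρ : 0 < ρ) (hr : r = ‖X‖) (hρr : 8 * ρ ≤ r / 2)
    (hhalf : ∀ x ∈ upperDomain D ε, x ∈ ball X (8 * ρ) → 0 < inner ℝ n (x - V))
    (huM : ∀ x ∈ upperDomain D ε, x ∈ ball X (8 * ρ) → u x ≤ M)
    (hd : inner ℝ n (X - V) = d) (hdρ : d < ρ) (hy : y ∈ ball X d)
    (hyU : y ∈ upperDomain D ε) : u y ≤ 2 * M / ρ * d := by
  set t : ℝ := inner ℝ n (y - V) with ht
  rw [mem_ball] at hy
  have hyb : y ∈ ball X (8 * ρ) := by rw [mem_ball]; linarith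
  have ht0 : 0 < t := hhalf y hyU hyb
  have htd : t < 2 * d := by
    have := (abs_le.mp (dist_inner_le hn V X y)).2
    linarith
  -- The barrier is centred at the foot of the perpendicular from y to the edge line. Since t < 2d <
  -- 2ρ, the disk of radius 2ρ about p stays within 5ρ of X, and the resulting bound 2Mt/(2ρ) is
  -- below 2Md/ρ.
  set p := y - t • n with hp
  have hpy : p + t • n = y := sub_add_cancel y _
  have hinp : ∀ z, inner ℝ n (z - p) = inner ℝ n (z - V) := by
    intro z
    have h1 : z - p = (z - V) - (y - V) + t • n := by rw [hp]; abel
    rw [h1, inner_add_right, inner_sub_right, inner_smul_right, real_inner_self_eq_norm_sq, hn,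
      ← ht]
    ring
  have hdist : dist p X < 3 * ρ := by
    have h1 : dist p y = t := by
      rw [hp, dist_eq_norm, sub_sub_cancel_left, norm_neg, norm_smul, hn, mul_one,
        Real.norm_of_nonneg ht0.le]
    have := dist_triangle p y X
    linarith
  have hsub : closedBall p (2 * ρ) ⊆ ball X (8 * ρ) := by
    intro z hz
    rw [mem_closedBall] at hz
    rw [mem_ball]
    have := dist_triangle z p X
    linarith
  have hne : ∀ z ∈ ball X (8 * ρ), z ≠ 0 := by
    rintro z hz rfl
    rw [mem_ball, dist_zero_left] at hz
    linarith [norm_nonneg X]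
  have hcl : closure (upperDomain D ε ∩ ball p (2 * ρ)) ⊆
      closure (upperDomain D ε) ∩ ball X (8 * ρ) := fun z hz =>
    ⟨closure_mono inter_subset_left hz,
      hsub (closure_ball_subset_closedBall (closure_mono inter_subset_right hz))⟩
  have hmain := le_of_mem_halfPlane (G := upperDomain D ε) (u := u) (n := n) (p := p)
    (R := 2 * ρ) (M := M) (t := t) isOpen_upperDomain hn (by positivity) hM
    (fun z hz => hu.harmonic z hz.1.1 (hne z (hsub (ball_subset_closedBall hz.2))))
    (fun z hz => by
      have hz' := hcl hz
      refine (hu.continuous z (closure_upperDomain_subset hD hz'.1).1 (hne z hz'.2)).mono ?_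
      exact fun w hw => (closure_upperDomain_subset hD (hcl hw).1).1)
    (fun z hz hzU => (hu.boundary z (hcl hz).1 hzU (hne z (hcl hz).2)).le)
    (fun z hz => huM z hz.1 (hsub (ball_subset_closedBall hz.2)))
    (fun z hz => by
      rw [hinp]
      exact (hhalf z hz.1 (hsub (ball_subset_closedBall hz.2))).le)
    ht0 (by linarith) (by rw [hpy]; exact hyU)
  rw [hpy] at hmain
  refine hmain.trans ?_
  rw [div_le_iff₀ (by positivity)]
  have : 2 * M / ρ * d * (2 * ρ) = 4 * M * d := by field_simp; ring
  rw [this]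
  nlinarith

theorem IsDominatedPotential.norm_fderiv_le_upper (hα : 0 < α) (hα' : α < Real.pi)
    (hD : IsInclusionShape α μ D) (hε : 0 < ε) (hu : IsDominatedPotential D ε u) {κ : ℝ}
    (hκ : 0 < κ) (hκ2 : κ ≤ 1 / 2) (hκμ : κ ≤ μ - 1) {X : Plane} (hX : X ∈ upperDomain D ε)
    (hX1 : ‖X‖ < 1) : ‖fderiv ℝ u X‖ ≤ 128 / (Real.pi * κ) / ‖X‖ ^ 2 := by
  have hπ := Real.pi_pos
  have hXpos : 0 < X 1 := hX.2
  have hX0 : X ≠ 0 := by rintro rfl; simp at hXpos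
  set r := ‖X‖ with hr
  have hr0 : 0 < r := norm_pos_iff.mpr hX0
  -- The disk of radius 8ρ = κ|X| about X stays at distance at least |X|/2 from the origin because κ
  -- ≤ 1/2, and inside B_μ because |X| < 1 and κ ≤ μ − 1.
  set ρ := κ * r / 8 with hρ
  have hρ0 : 0 < ρ := by positivity
  have h8ρ : 8 * ρ = κ * r := by rw [hρ]; ring
  have hκr : κ * r ≤ r / 2 := by nlinarith
  have hnorm_lb : ∀ x ∈ ball X (8 * ρ), r / 2 ≤ ‖x‖ := by
    intro x hx
    rw [mem_ball, dist_comm, dist_eq_norm] at hx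
    have := norm_sub_norm_le X x
    linarith
  have hballμ : ball X (8 * ρ) ⊆ ball (0 : Plane) μ := by
    intro x hx
    rw [mem_ball, dist_eq_norm] at hx
    rw [mem_ball_zero_iff]
    have := norm_sub_norm_le x X
    have : κ * r < κ := by nlinarith
    linarith
  set M := (2 * Real.pi)⁻¹ * (r / 2)⁻¹ with hMdef
  have hM : 0 < M := by positivity
  have huM : ∀ x ∈ upperDomain D ε, x ∈ ball X (8 * ρ) → u x ≤ M := fun x hx hxb =>
    (hu.le_dipole x hx).trans (dipole_le (by positivity) (hnorm_lb x hxb))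
  have hn2 : ‖edgeNormal (α / 2)‖ = 1 := norm_edgeNormal _
  have hn1 : ‖reflect 0 (edgeNormal (α / 2))‖ = 1 := by rw [LinearIsometryEquiv.norm_map, hn2]
  have hUB : IsOpen (upperDomain D ε ∩ ball X (8 * ρ)) := isOpen_upperDomain.inter isOpen_ball
  have hpos2 : ∀ x ∈ upperDomain D ε, x ∈ ball X (8 * ρ) → 0 < edgeDistRight α ε x := by
    have := inner_pos_of_isOpen hUB hn2 (V := vertexRight ε) fun x hx =>
      ((mem_exteriorSet_iff hα hα' hD hε (hballμ hx.2) hx.1.2).mp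
        (exteriorDomain_subset hx.1.1)).2
    exact fun x hx hxb => this x ⟨hx, hxb⟩
  have hpos1 : ∀ x ∈ upperDomain D ε, x ∈ ball X (8 * ρ) → 0 < edgeDistLeft α ε x := by
    have := inner_pos_of_isOpen hUB hn1 (V := vertexLeft ε) fun x hx =>
      ((mem_exteriorSet_iff hα hα' hD hε (hballμ hx.2) hx.1.2).mp
        (exteriorDomain_subset hx.1.1)).1
    exact fun x hx hxb => this x ⟨hx, hxb⟩
  have hXb : X ∈ ball X (8 * ρ) := mem_ball_self (by positivity)
  have hballU : ∀ s, s ≤ ρ → s ≤ X 1 → s ≤ edgeDistLeft α ε X → s ≤ edgeDistRight α ε X →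
      ball X s ⊆ upperDomain D ε := by
    intro s hsρ hs1 hsL hsR
    have hcoord : ∀ y ∈ ball X s, 0 < y 1 := by
      intro y hy
      rw [mem_ball, dist_eq_norm] at hy
      have h1 := (abs_le.mp (abs_apply_le_norm (y - X) 1)).1
      have h2 : (y - X) 1 = y 1 - X 1 := rfl
      rw [h2] at h1
      linarith
    have hsubE : ball X s ⊆ exteriorSet D ε := by
      intro y hy
      have hyb : y ∈ ball X (8 * ρ) := ball_subset_ball (by linarith) hy
      refine (mem_exteriorSet_iff hα hα' hD hε (hballμ hyb) (hcoord y hy)).mpr ?_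
      rw [mem_ball] at hy
      have h1 := (abs_le.mp (dist_inner_le hn1 (vertexLeft ε) X y)).1
      have h2 := (abs_le.mp (dist_inner_le hn2 (vertexRight ε) X y)).1
      rw [← edgeDistLeft, ← edgeDistLeft] at h1
      rw [← edgeDistRight, ← edgeDistRight] at h2
      constructor <;> linarith
    exact fun y hy => ⟨mem_exteriorDomain_of_isOpen isOpen_ball hsubE hy, hcoord y hy⟩
  have hharm : ∀ s, s ≤ ρ → ball X s ⊆ upperDomain D ε → HarmonicOnNhd u (ball X s) := by
    intro s hs hsub y hy
    refine hu.harmonic y (hsub hy).1 ?_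
    rintro rfl
    simpa using (hsub hy).2
  -- The distance from X to the nearest of the three boundary lines.
  set d := min (X 1) (min (edgeDistLeft α ε X) (edgeDistRight α ε X)) with hd
  have hd1 : d ≤ X 1 := min_le_left _ _
  have hdL : d ≤ edgeDistLeft α ε X := (min_le_right _ _).trans (min_le_left _ _)
  have hdR : d ≤ edgeDistRight α ε X := (min_le_right _ _).trans (min_le_right _ _)
  have hd0 : 0 < d := lt_min hXpos (lt_min (hpos1 X hX hXb) (hpos2 X hX hXb))
  have hMρ : 16 * M / ρ = 128 / (Real.pi * κ) / r ^ 2 := by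
    rw [hMdef, hρ]
    field_simp
    ring
  -- Away from the lines the bound M on the disk of radius ρ suffices. Otherwise u ≤ 2Md/ρ on the
  -- disk of radius d, and 8 · (2Md/ρ)/d = 16M/ρ.
  rcases le_or_gt ρ d with hρd | hdρ
  · have hsub := hballU ρ le_rfl (hρd.trans hd1) (hρd.trans hdL) (hρd.trans hdR)
    have hfd := norm_fderiv_le_of_nonneg hρ0 (hharm ρ le_rfl hsub)
      (fun y hy => hu.nonneg y (hsub hy))
      (fun y hy => huM y (hsub hy) (ball_subset_ball (by linarith) hy)) hM
    rw [← hMρ]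
    refine hfd.trans ?_
    gcongr
    norm_num
  · have hsub := hballU d hdρ.le hd1 hdL hdR
    have hgrow : ∀ y ∈ ball X d, u y ≤ 2 * M / ρ * d := by
      intro y hy
      have hyU := hsub hy
      have hyb : y ∈ ball X (8 * ρ) := ball_subset_ball (by linarith) hy
      rcases min_choice (X 1) (min (edgeDistLeft α ε X) (edgeDistRight α ε X)) with h | h
      -- Near the axis no barrier is needed, since the majorant N is itself linear in x₂.
      · have hdX : d = X 1 := h
        have hy1 : y 1 ≤ 2 * d := by
          rw [mem_ball, dist_eq_norm] at hy
          have h1 := (abs_le.mp (abs_apply_le_norm (y - X) 1)).2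
          have h2 : (y - X) 1 = y 1 - X 1 := rfl
          rw [h2] at h1
          linarith
        refine (hu.le_dipole y hyU).trans ((dipole_le_of_apply_le (by positivity)
          (hnorm_lb y hyb) (le_of_lt hyU.2) hy1).trans ?_)
        have e1 : (2 * Real.pi)⁻¹ * (2 * d / (r / 2) ^ 2) = M * d * (4 / r) := by
          rw [hMdef]; field_simp; norm_num
        have e2 : 2 * M / ρ * d = M * d * (16 / (κ * r)) := by
          rw [hρ]; field_simp; ring
        rw [e1, e2]
        refine mul_le_mul_of_nonneg_left ?_ (by positivity)
        rw [div_le_div_iff₀ hr0 (by positivity)]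
        nlinarith
      · rcases min_choice (edgeDistLeft α ε X) (edgeDistRight α ε X) with h' | h'
        · exact hu.growth hD hn1 (V := vertexLeft ε) hM hρ0 hr (by linarith) hpos1 huM
            (h'.symm.trans h.symm) hdρ hy hyU
        · exact hu.growth hD hn2 (V := vertexRight ε) hM hρ0 hr (by linarith) hpos2 huM
            (h'.symm.trans h.symm) hdρ hy hyU
    have hfd := norm_fderiv_le_of_nonneg hd0 (hharm d hdρ.le hsub)
      (fun y hy => hu.nonneg y (hsub hy)) hgrow (by positivity)
    rw [← hMρ]
    refine hfd.trans (le_of_eq ?_)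
    field_simp
    ring

/-- Below the axis the bound follows from oddness. On the axis u is smooth off the origin, and the
bound passes to the limit from above. -/
theorem IsDominatedPotential.norm_fderiv_le (hα : 0 < α) (hα' : α < Real.pi)
    (hD : IsInclusionShape α μ D) (hε : 0 < ε) (hu : IsDominatedPotential D ε u) {κ : ℝ}
    (hκ : 0 < κ) (hκ2 : κ ≤ 1 / 2) (hκμ : κ ≤ μ - 1) {X : Plane} (hX : X ∈ exteriorDomain D ε)
    (hX0 : X ≠ 0) (hX1 : ‖X‖ < 1) : ‖fderiv ℝ u X‖ ≤ 128 / (Real.pi * κ) / ‖X‖ ^ 2 := by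
  have hupper : ∀ Y ∈ upperDomain D ε, ‖Y‖ < 1 →
      ‖fderiv ℝ u Y‖ ≤ 128 / (Real.pi * κ) / ‖Y‖ ^ 2 := fun Y hY hY1 =>
    hu.norm_fderiv_le_upper hα hα' hD hε hκ hκ2 hκμ hY hY1
  rcases lt_trichotomy (X 1) 0 with hneg | hzero | hpos
  · have h1 := hupper (reflect 1 X) ⟨reflect_mem_exteriorDomain hD 1 hX, by simpa using hneg⟩
      (by rwa [LinearIsometryEquiv.norm_map])
    have h2 : u =ᶠ[𝓝 X] fun y => -u (reflect 1 y) := by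
      filter_upwards [isOpen_exteriorDomain.mem_nhds hX, isOpen_compl_singleton.mem_nhds hX0]
        with y hy hy0
      rw [hu.odd y (exteriorDomain_subset hy) hy0, neg_neg]
    have h3 : fderiv ℝ (fun y => u (reflect 1 y)) X = (fderiv ℝ u (reflect 1 X)).comp
        ((reflect 1).toContinuousLinearEquiv : Plane →L[ℝ] Plane) :=
      (reflect 1).toContinuousLinearEquiv.comp_right_fderiv (f := u) (x := X)
    rw [h2.fderiv_eq, fderiv_fun_neg, norm_neg, h3]
    rw [LinearIsometryEquiv.norm_map] at h1
    refine le_trans (le_of_eq ?_) h1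
    exact ContinuousLinearMap.opNorm_comp_linearIsometryEquiv _ (reflect 1)
  · have hcd := (hu.harmonic X hX hX0).1
    have hcf : ContinuousAt (fderiv ℝ u) X :=
      (hcd.fderiv_right (m := 1) (by norm_num)).continuousAt
    have htend := tendsto_add_smul X e₁
    have hl := (hcf.tendsto.comp htend).norm
    have hrt : Tendsto (fun t : ℝ => 128 / (Real.pi * κ) / ‖X + t • e₁‖ ^ 2) (𝓝[>] 0)
        (𝓝 (128 / (Real.pi * κ) / ‖X‖ ^ 2)) :=
      tendsto_const_nhds.div (htend.norm.pow 2) (pow_ne_zero 2 (norm_ne_zero_iff.mpr hX0))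
    refine le_of_tendsto_of_tendsto hl hrt ?_
    have hball : ball (0 : Plane) 1 ∈ 𝓝 X := isOpen_ball.mem_nhds (by simpa using hX1)
    filter_upwards [htend.eventually (isOpen_exteriorDomain.mem_nhds hX), htend.eventually hball,
      self_mem_nhdsWithin] with t ht1 ht2 ht0
    refine hupper _ ⟨ht1, ?_⟩ (by simpa using ht2)
    have : 0 < t := ht0
    simpa [hzero] using this
  · exact hupper X ⟨hX, hpos⟩ hX1

end BowTie

theorem theorem5p1 (α μ : ℝ) (hα : 0 < α) (hα' : α < Real.pi) (hμ : 1 < μ)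
    (D : Set Plane) (hD : IsInclusionShape α μ D) :
    ∃ C : ℝ, 0 < C ∧ ∀ ε : ℝ, 0 < ε → ∀ u : Plane → ℝ,
      IsEmitterPotential (inclusionLeft D ε) (inclusionRight D ε) (vertexLeft ε) (vertexRight ε)
        !₂[0, 1] 0 u →
      ∀ X : Plane, X ∈ Metric.ball (0 : Plane) 1 →
        X ∉ closure (inclusionLeft D ε ∪ inclusionRight D ε) ∪ {0} →
        DifferentiableAt ℝ u X ∧ ‖gradient u X‖ ≤ C / ‖X‖ ^ 2 := by
  have hκ : 0 < min (1 / 2) (μ - 1) := lt_min (by norm_num) (by linarith)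
  -- The constant depends on μ alone; neither α nor the shape of D outside B_μ enters.
  refine ⟨128 / (Real.pi * min (1 / 2) (μ - 1)), by positivity, fun ε hε u hu X hX hXn => ?_⟩
  rw [mem_union, not_or] at hXn
  have hX0 : X ≠ 0 := hXn.2
  have hdom := BowTie.IsDominatedPotential.of_isBowTiePotential hα hα' (by linarith) hε hD hu
  refine ⟨(hdom.harmonic X hXn.1 hX0).1.differentiableAt (by norm_num), ?_⟩
  have hgrad : ‖gradient u X‖ = ‖fderiv ℝ u X‖ := LinearIsometryEquiv.norm_map _ _
  rw [hgrad]
  exact hdom.norm_fderiv_le hα hα' hD hε hκ (min_le_left _ _) (min_le_right _ _) hXn.1 hX0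
    (by simpa using hX)
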